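/- Let $(\Omega,\mathcal F,(\mathcal F_t)_{t\ge 0},\mathbb P)$ be a filtered probability space satisfying the usual conditions. Let $\xi=(\xi(t))_{t\ge0}$ and $\eta=(\eta(t))_{t\ge0}$ be two nonnegative measurable $\mathcal F_t$-adapted real processes such that $t\mapsto\xi(t)$ is càdlàg, let $A=(A_t)_{t\ge 0}$ be a continuous nondecreasing $\mathcal F_t$-adapted process with $A_0=0$, and let $M=(M_t)_{t\ge0}$ be a càdlàg (not necessarily continuous) local martingale with $M_0=0$. Suppose that, almost surely, $$\xi(t)\le \xi(0)+\int_0^t\eta(s)\,\mathrm ds+\int_0^t\xi(s)\,\mathrm dA_s+M_t\qquad\text{for every } t\ge 0,$$ where the integrals take values in $[0,\infty]$ and $\mathrm dA_s$ is the Lebesgue–Stieltjes measure of the path of $A$. Then for all $0<q<p<1$ and all $t\ge 0$, $$\Big[\mathbb E\Big(\sup_{s\in[0,t]}\xi(s)\Big)^{q}\Big]^{1/q}\le\Big(\frac{p}{p-q}\Big)^{1/q}\Big(\mathbb E\,\mathrm e^{pA_t/(1-p)}\Big)^{(1-p)/p}\;\mathbb E\Big(\xi(0)+\int_0^t\eta(s)\,\mathrm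 ds\Big),$$ as an inequality in $[0,\infty]$, with the convention $\infty\cdot 0=0$. -/

import Mathlib

open MeasureTheory ProbabilityTheory Filter Set
open scoped NNReal ENNReal Topology

namespace StochGronwall

/-- The usual conditions: the filtration is right-continuous, and `𝓕 0` contains every subset of a
`P`-null set (so that `P` is complete). -/
structure UsualConditions {Ω : Type*} {mΩ : MeasurableSpace Ω} (𝓕 : Filtration ℝ≥0 mΩ)
    (P : Measure Ω) : Prop where
  rightContinuous : 𝓕.IsRightContinuous
  complete : ∀ s : Set Ω, P s = 0 → MeasurableSet[𝓕 0] s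

/-- A path is càdlàg: right-continuous with (finite) left limits at every time. -/
def IsCadlag (x : ℝ≥0 → ℝ) : Prop :=
  (∀ t, ContinuousWithinAt x (Ici t) t) ∧ ∀ t, ∃ l : ℝ, Tendsto x (𝓝[<] t) (𝓝 l)

/-- A (càdlàg, not necessarily continuous) local martingale. `Locally` asks for stopping times
`τ n` which a.s. increase to infinity such that every process
`t ↦ 1_{τ n > 0} X (min t (τ n))` is a martingale. -/
structure IsLocalMartingale {Ω : Type*} {mΩ : MeasurableSpace Ω} (X : ℝ≥0 → Ω → ℝ)
    (𝓕 : Filtration ℝ≥0 mΩ) (P : Measure Ω) : Prop where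
  adapted : StronglyAdapted 𝓕 X
  cadlag : ∀ᵐ ω ∂P, IsCadlag (fun t => X t ω)
  locally_martingale : Locally (fun Y : ℝ≥0 → Ω → ℝ => Martingale Y 𝓕 P) 𝓕 X P

open Classical in
/-- The Lebesgue–Stieltjes measure `da` on `[0, ∞)` of a nondecreasing path `a`, without mass at
`0`. For paths that are not nondecreasing (a null set of paths in what follows) it is `0`. -/
noncomputable def pathMeasure (a : ℝ≥0 → ℝ) : Measure ℝ≥0 :=
  if h : Monotone a then h.stieltjesFunction.measure else 0

end StochGronwall

namespace StochGronwall

/-! ### Lebesgue–Stieltjes measures of continuous nondecreasing paths -/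

section Path

variable {a : ℝ≥0 → ℝ}

/-! Let `H` be `ξ 0` plus the integral of `η` over all of `[0, t]`. Integrating the hypothesis
against `e^{-A} dA` and integrating by parts removes the `dA` term: `e^{-A s} ξ s ≤ H + N s` for `s
≤ t`, where `N = e^{-A} M + ∫ M e^{-A} dA` plays the role of `∫ e^{-A} dM` (`exp_neg_mul_le`). No
stochastic integral is built: `N` is a pathwise Stieltjes expression.

After localization `M` becomes a martingale `Y`, and `N` must be shown to have constant integrals
over past events. This holds because right-endpoint Riemann sums of `∫ Y e^{-A} dA` have explicit
expectations (`setIntegral_rightSum`) and are uniformly integrable (`uniformIntegrable_rightSum`),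
so the identity survives the limit (`setIntegral_integral`, `setIntegral_discounted`).

Cut the event that `ξ` exceeds `c` at a grid time into disjoint first-passage events. On each of
them `N` can be moved to the common time `t`, where `H + N t ≥ 0`; hence the expectation of `e^{-A}
ξ` at first passage is at most `E H` (`sum_lintegral_discounted_le`). Hölder's inequality removes
the discount and yields a weak-type bound of order `p` (`rpow_mul_measure_le`). Integrating the tail
produces the factor `p / (p - q)` (`lintegral_rpow_le_of_tail_le`). The bound depends neither on the
grid nor on the stopping time, so Fatou's lemma finishes the proof. -/

lemma pathMeasure_Ioc (hc : Continuous a) (hm : Monotone a) (x y : ℝ≥0) :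
    pathMeasure a (Ioc x y) = ENNReal.ofReal (a y - a x) := by
  rw [pathMeasure, dif_pos hm, StieltjesFunction.measure_Ioc, hm.stieltjesFunction_eq,
    hm.stieltjesFunction_eq, (hc.continuousWithinAt).rightLim_eq,
    (hc.continuousWithinAt).rightLim_eq]

lemma pathMeasure_singleton (hc : Continuous a) (hm : Monotone a) (x : ℝ≥0) :
    pathMeasure a {x} = 0 := by
  have h : (hm.stieltjesFunction : ℝ≥0 → ℝ) = a := by
    funext y
    rw [hm.stieltjesFunction_eq, (hc.continuousWithinAt).rightLim_eq]
  rw [pathMeasure, dif_pos hm, StieltjesFunction.measure_singleton, h,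
    (hc.continuousWithinAt).leftLim_eq, sub_self, ENNReal.ofReal_zero]

lemma Icc_ae_eq_Ioc_pathMeasure (hc : Continuous a) (hm : Monotone a) (x y : ℝ≥0) :
    Icc x y =ᵐ[pathMeasure a] Ioc x y :=
  have : NullSingletonClass (pathMeasure a) := ⟨pathMeasure_singleton hc hm⟩
  Ioc_ae_eq_Icc.symm

lemma isFiniteMeasure_restrict_Ioc (hc : Continuous a) (hm : Monotone a) (x y : ℝ≥0) :
    IsFiniteMeasure ((pathMeasure a).restrict (Ioc x y)) :=
  ⟨by rw [Measure.restrict_apply_univ, pathMeasure_Ioc hc hm]; exact ENNReal.ofReal_lt_top⟩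

lemma isFiniteMeasure_restrict_Icc (hc : Continuous a) (hm : Monotone a) (x y : ℝ≥0) :
    IsFiniteMeasure ((pathMeasure a).restrict (Icc x y)) := by
  rw [Measure.restrict_congr_set (Icc_ae_eq_Ioc_pathMeasure hc hm x y)]
  exact isFiniteMeasure_restrict_Ioc hc hm x y

lemma exp_neg_le_one_of_path (hm : Monotone a) (h0 : a 0 = 0) (u : ℝ≥0) : Real.exp (-a u) ≤ 1 := by
  have := hm (zero_le (a := u))
  rw [Real.exp_le_one_iff]; linarith

lemma integrableOn_exp_neg (hc : Continuous a) (hm : Monotone a) (h0 : a 0 = 0) (x y : ℝ≥0) :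
    IntegrableOn (fun u => Real.exp (-a u)) (Ioc x y) (pathMeasure a) := by
  have := isFiniteMeasure_restrict_Ioc hc hm x y
  refine Integrable.of_bound (by fun_prop) 1 (ae_of_all _ fun u => ?_)
  rw [Real.norm_eq_abs, Real.abs_exp]
  exact exp_neg_le_one_of_path hm h0 u

/-- On one cell both quantities lie between `e^{-a y} (a y - a x)` and `e^{-a x} (a y - a x)`, so
the error is quadratic in the increment. Each bisection therefore halves the total error, and
letting `n → ∞` gives the exact change of variables. -/
lemma abs_integral_exp_neg_sub_le (hc : Continuous a) (hm : Monotone a) (h0 : a 0 = 0) (n : ℕ)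
    {x y : ℝ≥0} (hxy : x ≤ y) :
    |(∫ u in Ioc x y, Real.exp (-a u) ∂pathMeasure a) - (Real.exp (-a x) - Real.exp (-a y))| ≤
      (a y - a x) ^ 2 / 2 ^ n := by
  induction n generalizing x y with
  | zero =>
    have hfin := isFiniteMeasure_restrict_Ioc hc hm x y
    have hd : 0 ≤ a y - a x := sub_nonneg.2 (hm hxy)
    have hx : 0 ≤ a x := h0 ▸ hm (zero_le (a := x))
    have hreal : (pathMeasure a).real (Ioc x y) = a y - a x := by
      rw [Measure.real, pathMeasure_Ioc hc hm, ENNReal.toReal_ofReal hd]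
    have hup : (∫ u in Ioc x y, Real.exp (-a u) ∂pathMeasure a) ≤
        Real.exp (-a x) * (a y - a x) := by
      calc _ ≤ ∫ u in Ioc x y, Real.exp (-a x) ∂pathMeasure a :=
            setIntegral_mono_on (integrableOn_exp_neg hc hm h0 x y) (integrable_const _)
              measurableSet_Ioc fun u hu => Real.exp_le_exp.2 (neg_le_neg (hm hu.1.le))
        _ = _ := by simp [hreal, mul_comm]
    have hlo : Real.exp (-a y) * (a y - a x) ≤
        (∫ u in Ioc x y, Real.exp (-a u) ∂pathMeasure a) := by
      calc _ = ∫ u in Ioc x y, Real.exp (-a y) ∂pathMeasure a := by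
            simp [hreal, mul_comm]
        _ ≤ _ := setIntegral_mono_on (integrable_const _) (integrableOn_exp_neg hc hm h0 x y)
              measurableSet_Ioc fun u hu => Real.exp_le_exp.2 (neg_le_neg (hm hu.2))
    have hprod : Real.exp (-a y) = Real.exp (-a x) * Real.exp (-(a y - a x)) := by
      rw [← Real.exp_add]; ring_nf
    have hle1 : Real.exp (-a x) ≤ 1 := exp_neg_le_one_of_path hm h0 x
    have hpos := Real.exp_pos (-a x)
    set E := Real.exp (-a x)
    set d := a y - a x
    have h1 : 1 - d ≤ Real.exp (-d) := by linarith [Real.add_one_le_exp (-d)]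
    have h2 : Real.exp (-d) * (1 + d) ≤ 1 := by
      have h3 := Real.add_one_le_exp d
      calc Real.exp (-d) * (1 + d) ≤ Real.exp (-d) * Real.exp d := by gcongr; linarith
        _ = 1 := by rw [← Real.exp_add]; simp
    rw [hprod] at hlo ⊢
    rw [abs_le]
    simp only [pow_zero, div_one]
    constructor
    · have h4 : E * (1 - Real.exp (-d) * (1 + d)) ≤ 1 * d ^ 2 := by
        apply mul_le_mul hle1 _ (by linarith) zero_le_one
        nlinarith
      nlinarith
    · have h4 : E * (d - 1 + Real.exp (-d)) ≤ 1 * d ^ 2 := by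
        apply mul_le_mul hle1 _ (by linarith) zero_le_one
        nlinarith
      nlinarith
  | succ n ih =>
    have hmid : (a x + a y) / 2 ∈ Icc (a x) (a y) := by
      have := hm hxy
      constructor <;> linarith
    -- The cut is at the midpoint of the values of `a`, not of time, so both halves carry exactly
    -- half the increment.
    obtain ⟨z, hz, haz⟩ := intermediate_value_Icc hxy hc.continuousOn hmid
    have h1 := ih hz.1
    have h2 := ih hz.2
    have hsplit : (∫ u in Ioc x y, Real.exp (-a u) ∂pathMeasure a) =
        (∫ u in Ioc x z, Real.exp (-a u) ∂pathMeasure a) +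
        ∫ u in Ioc z y, Real.exp (-a u) ∂pathMeasure a := by
      rw [← Ioc_union_Ioc_eq_Ioc hz.1 hz.2]
      exact setIntegral_union (Ioc_disjoint_Ioc_of_le le_rfl) measurableSet_Ioc
        (integrableOn_exp_neg hc hm h0 x z) (integrableOn_exp_neg hc hm h0 z y)
    rw [hsplit]
    have e1 : a z - a x = (a y - a x) / 2 := by rw [haz]; ring
    have e2 : a y - a z = (a y - a x) / 2 := by rw [haz]; ring
    rw [e1] at h1
    rw [e2] at h2
    have e3 : (a y - a x) ^ 2 / 2 ^ (n + 1) =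
        ((a y - a x) / 2) ^ 2 / 2 ^ n + ((a y - a x) / 2) ^ 2 / 2 ^ n := by
      rw [pow_succ]; ring
    rw [e3]
    refine le_trans ?_ (add_le_add h1 h2)
    refine le_trans (le_of_eq ?_) (abs_add_le _ _)
    congr 1; ring

/-- Change of variables: `∫_{(x, y]} e^{-a} da = e^{-a x} - e^{-a y}`. -/
lemma integral_exp_neg (hc : Continuous a) (hm : Monotone a) (h0 : a 0 = 0)
    {x y : ℝ≥0} (hxy : x ≤ y) :
    ∫ u in Ioc x y, Real.exp (-a u) ∂pathMeasure a = Real.exp (-a x) - Real.exp (-a y) := by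
  rw [← sub_eq_zero, ← abs_nonpos_iff]
  refine ge_of_tendsto' (x := atTop) (f := fun n : ℕ => (a y - a x) ^ 2 / (2 : ℝ) ^ n) ?_
    (fun n => abs_integral_exp_neg_sub_le hc hm h0 n hxy)
  exact tendsto_const_nhds.div_atTop (tendsto_pow_atTop_atTop_of_one_lt one_lt_two)

end Path

/-! ### Right-endpoint Riemann sums -/

/-- The `i`-th point of the partition of `[x, y]` into `n + 1` intervals of equal length. -/
noncomputable def gridPoint (x y : ℝ≥0) (n i : ℕ) : ℝ≥0 := x + i / (n + 1) * (y - x)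

lemma gridPoint_zero (x y : ℝ≥0) (n : ℕ) : gridPoint x y n 0 = x := by simp [gridPoint]

lemma gridPoint_last {x y : ℝ≥0} (h : x ≤ y) (n : ℕ) : gridPoint x y n (n + 1) = y := by
  have : ((n + 1 : ℕ) : ℝ≥0) / (n + 1) = 1 := by
    push_cast; exact div_self (by positivity)
  rw [gridPoint, this, one_mul, add_tsub_cancel_of_le h]

lemma gridPoint_mono (x y : ℝ≥0) (n : ℕ) : Monotone (gridPoint x y n) := by
  intro i j h
  unfold gridPoint
  gcongr

lemma gridPoint_succ (x y : ℝ≥0) (n i : ℕ) :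
    gridPoint x y n (i + 1) = gridPoint x y n i + (y - x) / (n + 1) := by
  unfold gridPoint
  push_cast
  ring

lemma exists_mem_Ioc_gridPoint {x y u : ℝ≥0} (h : u ∈ Ioc x y) (n : ℕ) :
    ∃ i ∈ Finset.range (n + 1), u ∈ Ioc (gridPoint x y n i) (gridPoint x y n (i + 1)) := by
  have hU := (gridPoint_mono x y n).biUnion_Ico_Ioc_map_succ 0 (n + 1)
  rw [gridPoint_zero, gridPoint_last (h.1.le.trans h.2)] at hU
  rw [← hU] at h
  simp only [mem_iUnion] at h
  obtain ⟨i, hi, hu⟩ := h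
  exact ⟨i, Finset.mem_range.2 hi.2, hu⟩

/-- The step function taking on each cell of the partition the value of `f` at the right end. -/
noncomputable def rightStep (f : ℝ≥0 → ℝ) (x y : ℝ≥0) (n : ℕ) (u : ℝ≥0) : ℝ :=
  ∑ i ∈ Finset.range (n + 1),
    (Ioc (gridPoint x y n i) (gridPoint x y n (i + 1))).indicator
      (fun _ => f (gridPoint x y n (i + 1))) u

lemma exists_rightStep_eq (f : ℝ≥0 → ℝ) {x y u : ℝ≥0} (h : u ∈ Ioc x y) (n : ℕ) :
    ∃ r, u ≤ r ∧ r ≤ y ∧ r ≤ u + (y - x) / (n + 1) ∧ (∃ i < n + 2, r = gridPoint x y n i) ∧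
      rightStep f x y n u = f r := by
  obtain ⟨i, hi, hu⟩ := exists_mem_Ioc_gridPoint h n
  refine ⟨gridPoint x y n (i + 1), hu.2, ?_, ?_,
    ⟨i + 1, Nat.succ_lt_succ (Finset.mem_range.1 hi), rfl⟩, ?_⟩
  · have hle := gridPoint_mono x y n (show i + 1 ≤ n + 1 from Finset.mem_range.1 hi)
    rwa [gridPoint_last (h.1.le.trans h.2)] at hle
  · rw [gridPoint_succ]; gcongr; exact hu.1.le
  · rw [rightStep, Finset.sum_eq_single_of_mem i hi, indicator_of_mem hu]
    intro j _ hji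
    refine indicator_of_notMem (fun hj => ?_) _
    exact ((gridPoint_mono x y n).pairwise_disjoint_on_Ioc_succ hji).le_bot ⟨hj, hu⟩

lemma measurable_rightStep (f : ℝ≥0 → ℝ) (x y : ℝ≥0) (n : ℕ) : Measurable (rightStep f x y n) :=
  Finset.measurable_fun_sum _ fun _ _ => measurable_const.indicator measurableSet_Ioc

/-- The sampling points lie to the right of `u` within one mesh width, so right-continuity suffices.
This is why cells are sampled at their right ends. -/
lemma tendsto_rightStep {f : ℝ≥0 → ℝ} (hf : ∀ u, ContinuousWithinAt f (Ici u) u) {x y u : ℝ≥0}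
    (h : u ∈ Ioc x y) : Tendsto (fun n => rightStep f x y n u) atTop (𝓝 (f u)) := by
  choose r hr using exists_rightStep_eq f h
  have heq : (fun n => rightStep f x y n u) = fun n => f (r n) := funext fun n => (hr n).2.2.2.2
  rw [heq]
  refine (hf u).tendsto.comp (tendsto_nhdsWithin_iff.2 ⟨?_, Eventually.of_forall fun n => (hr n).1⟩)
  refine tendsto_of_tendsto_of_tendsto_of_le_of_le tendsto_const_nhds ?_ (fun n => (hr n).1)
    (fun n => (hr n).2.2.1)
  have h1 : Tendsto (fun n : ℕ => (y - x) / ((n : ℝ≥0) + 1)) atTop (𝓝 0) := by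
    rw [← NNReal.tendsto_coe]
    simpa [Function.comp_def] using (tendsto_const_div_atTop_nhds_zero_nat ((y - x : ℝ≥0) : ℝ)).comp
      (tendsto_add_atTop_nat 1)
  simpa using tendsto_const_nhds.add h1

/-! ### Riemann sums of a right-continuous path against `e^{-a} da` -/

section Riemann

variable {a f : ℝ≥0 → ℝ} {x y : ℝ≥0} {C : ℝ}

lemma norm_rightStep_mul_exp_le (hm : Monotone a) (h0 : a 0 = 0)
    (hC : ∀ u ∈ Icc x y, |f u| ≤ C) (n : ℕ) {u : ℝ≥0} (hu : u ∈ Ioc x y) :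
    ‖rightStep f x y n u * Real.exp (-a u)‖ ≤ C := by
  obtain ⟨r, h1, h2, -, -, h4⟩ := exists_rightStep_eq f hu n
  have h5 := hC r ⟨hu.1.le.trans h1, h2⟩
  rw [h4, norm_mul, Real.norm_eq_abs, Real.norm_eq_abs, Real.abs_exp]
  calc |f r| * Real.exp (-a u) ≤ |f r| * 1 := by
        gcongr; exact exp_neg_le_one_of_path hm h0 u
    _ ≤ C := by linarith

lemma integrableOn_mul_exp_neg (hc : Continuous a) (hm : Monotone a) (h0 : a 0 = 0)
    (hf : ∀ u, ContinuousWithinAt f (Ici u) u) (hC : ∀ u ∈ Icc x y, |f u| ≤ C) :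
    IntegrableOn (fun u => f u * Real.exp (-a u)) (Ioc x y) (pathMeasure a) := by
  have := isFiniteMeasure_restrict_Ioc hc hm x y
  refine Integrable.of_bound (C := C) ?_ ?_
  · refine AEStronglyMeasurable.mul ?_ (by fun_prop)
    -- Measurability of `f` is not assumed; it comes from right-continuity, as a limit of step
    -- functions.
    refine aestronglyMeasurable_of_tendsto_ae atTop (f := rightStep f x y)
      (fun n => (measurable_rightStep f x y n).aestronglyMeasurable) ?_
    filter_upwards [ae_restrict_mem measurableSet_Ioc] with u hu using tendsto_rightStep hf hu
  · filter_upwards [ae_restrict_mem measurableSet_Ioc] with u hu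
    rw [norm_mul, Real.norm_eq_abs, Real.norm_eq_abs, Real.abs_exp]
    calc |f u| * Real.exp (-a u) ≤ |f u| * 1 := by
          gcongr; exact exp_neg_le_one_of_path hm h0 u
      _ ≤ C := by linarith [hC u ⟨hu.1.le, hu.2⟩]

lemma integral_rightStep_mul_exp_neg (hc : Continuous a) (hm : Monotone a) (h0 : a 0 = 0)
    (hxy : x ≤ y) (n : ℕ) :
    ∫ u in Ioc x y, rightStep f x y n u * Real.exp (-a u) ∂pathMeasure a =
      ∑ i ∈ Finset.range (n + 1), f (gridPoint x y n (i + 1)) *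
        (Real.exp (-a (gridPoint x y n i)) - Real.exp (-a (gridPoint x y n (i + 1)))) := by
  have hrw : ∀ u, rightStep f x y n u * Real.exp (-a u) = ∑ i ∈ Finset.range (n + 1),
      (Ioc (gridPoint x y n i) (gridPoint x y n (i + 1))).indicator
        (fun u => f (gridPoint x y n (i + 1)) * Real.exp (-a u)) u := by
    intro u
    rw [rightStep, Finset.sum_mul]
    refine Finset.sum_congr rfl fun i _ => ?_
    by_cases h : u ∈ Ioc (gridPoint x y n i) (gridPoint x y n (i + 1)) <;> simp [h]
  simp_rw [hrw]
  rw [integral_finsetSum]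
  · refine Finset.sum_congr rfl fun i hi => ?_
    have hsub : Ioc (gridPoint x y n i) (gridPoint x y n (i + 1)) ⊆ Ioc x y := by
      refine Ioc_subset_Ioc (by simp [gridPoint]) ?_
      have hle := gridPoint_mono x y n (show i + 1 ≤ n + 1 from Finset.mem_range.1 hi)
      rwa [gridPoint_last hxy] at hle
    rw [setIntegral_indicator measurableSet_Ioc, inter_eq_self_of_subset_right hsub,
      integral_const_mul, integral_exp_neg hc hm h0 (gridPoint_mono x y n (Nat.le_succ i))]
  · intro i _
    exact ((integrableOn_exp_neg hc hm h0 x y).const_mul _).indicator measurableSet_Ioc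

lemma tendsto_riemannSum (hc : Continuous a) (hm : Monotone a) (h0 : a 0 = 0)
    (hf : ∀ u, ContinuousWithinAt f (Ici u) u) (hC : ∀ u ∈ Icc x y, |f u| ≤ C) (hxy : x ≤ y) :
    Tendsto (fun n : ℕ => ∑ i ∈ Finset.range (n + 1), f (gridPoint x y n (i + 1)) *
        (Real.exp (-a (gridPoint x y n i)) - Real.exp (-a (gridPoint x y n (i + 1))))) atTop
      (𝓝 (∫ u in Ioc x y, f u * Real.exp (-a u) ∂pathMeasure a)) := by
  have := isFiniteMeasure_restrict_Ioc hc hm x y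
  simp_rw [← integral_rightStep_mul_exp_neg (f := f) hc hm h0 hxy]
  refine tendsto_integral_of_dominated_convergence (fun _ => C) (fun n => ?_)
    (integrable_const _) (fun n => ?_) ?_
  · exact (measurable_rightStep f x y n).aestronglyMeasurable.mul (by fun_prop)
  · filter_upwards [ae_restrict_mem measurableSet_Ioc] with u hu
      using norm_rightStep_mul_exp_le hm h0 hC n hu
  · filter_upwards [ae_restrict_mem measurableSet_Ioc] with u hu
      using (tendsto_rightStep hf hu).mul_const _

end Riemann

/-- The left limit and right-continuity bound `f` near each point; compactness of `[0, t]` makes the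
bound uniform. -/
lemma IsCadlag.exists_bound {f : ℝ≥0 → ℝ} (hf : IsCadlag f) (t : ℝ≥0) :
    ∃ C, ∀ u ∈ Icc 0 t, |f u| ≤ C := by
  refine isCompact_Icc.induction_on (p := fun s => ∃ C, ∀ u ∈ s, |f u| ≤ C) ⟨0, by simp⟩
    (fun s s' h ⟨C, hC⟩ => ⟨C, fun u hu => hC u (h hu)⟩) ?_ ?_
  · rintro s s' ⟨C, hC⟩ ⟨D, hD⟩
    refine ⟨max C D, fun u hu => ?_⟩
    rcases hu with hu | hu
    · exact (hC u hu).trans (le_max_left _ _)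
    · exact (hD u hu).trans (le_max_right _ _)
  · intro x _
    obtain ⟨l, hl⟩ := hf.2 x
    have h1 : ∀ᶠ u in 𝓝[<] x, |f u| ≤ |l| + 1 :=
      (hl.abs.eventually (gt_mem_nhds (lt_add_one |l|))).mono fun _ h => le_of_lt h
    have h2 : ∀ᶠ u in 𝓝[≥] x, |f u| ≤ |f x| + 1 :=
      ((hf.1 x).tendsto.abs.eventually (gt_mem_nhds (lt_add_one |f x|))).mono fun _ h => le_of_lt h
    have h3 : ∀ᶠ u in 𝓝 x, |f u| ≤ max (|l| + 1) (|f x| + 1) := by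
      rw [← nhdsLT_sup_nhdsGE x]
      exact eventually_sup.2 ⟨h1.mono fun _ h => h.trans (le_max_left _ _),
        h2.mono fun _ h => h.trans (le_max_right _ _)⟩
    exact ⟨_, mem_nhdsWithin_of_mem_nhds h3, _, fun u hu => hu⟩

/-! ### The pathwise Gronwall inequality -/

section Gronwall

variable {a ξ f : ℝ≥0 → ℝ}

lemma lintegral_exp_neg (hc : Continuous a) (hm : Monotone a) (h0 : a 0 = 0)
    {x y : ℝ≥0} (hxy : x ≤ y) :
    ENNReal.ofReal (Real.exp (-a y)) +
      ∫⁻ u in Ioc x y, ENNReal.ofReal (Real.exp (-a u)) ∂pathMeasure a =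
      ENNReal.ofReal (Real.exp (-a x)) := by
  rw [← ofReal_integral_eq_lintegral_ofReal (integrableOn_exp_neg hc hm h0 x y)
    (ae_of_all _ fun u => (Real.exp_pos _).le), integral_exp_neg hc hm h0 hxy,
    ← ENNReal.ofReal_add (Real.exp_pos _).le]
  · congr 1; ring
  · exact sub_nonneg.2 (Real.exp_le_exp.2 (neg_le_neg (hm hxy)))

/-- Integration by parts for `e^{-a}` and `G u = ∫_{[0, u]} g da`. -/
lemma lintegral_mul_exp_neg_eq (hc : Continuous a) (hm : Monotone a) (h0 : a 0 = 0)
    {g : ℝ≥0 → ℝ≥0∞} (hg : Measurable g) (s : ℝ≥0) :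
    ∫⁻ r in Ioc 0 s, g r * ENNReal.ofReal (Real.exp (-a r)) ∂pathMeasure a =
      (∫⁻ r in Icc 0 s, g r ∂pathMeasure a) * ENNReal.ofReal (Real.exp (-a s)) +
      ∫⁻ u in Ioc 0 s, (∫⁻ r in Icc 0 u, g r ∂pathMeasure a) * ENNReal.ofReal (Real.exp (-a u))
        ∂pathMeasure a := by
  have hns : NullSingletonClass (pathMeasure a) := ⟨pathMeasure_singleton hc hm⟩
  have hfin := isFiniteMeasure_restrict_Ioc hc hm 0 s
  set μ := pathMeasure a with hμ
  set E : ℝ≥0 → ℝ≥0∞ := fun u => ENNReal.ofReal (Real.exp (-a u)) with hE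
  have hEm : Measurable E := by
    have := hc.measurable
    fun_prop
  -- Write `E r` as `E s` plus the integral of `E` over `(r, s]`, then exchange the integrals by
  -- Tonelli. The missing endpoints are harmless because `μ` has no atoms.
  calc ∫⁻ r in Ioc 0 s, g r * E r ∂μ
      = ∫⁻ r in Ioc 0 s, (g r * E s +
          ∫⁻ u in Ioc 0 s, (Iio u).indicator (fun r => g r * E u) r ∂μ) ∂μ := by
        refine setLIntegral_congr_fun measurableSet_Ioc fun r hr => ?_
        have h1 : ∀ u, (Iio u).indicator (fun r => g r * E u) r =
            (Ioi r).indicator (fun u => g r * E u) u := fun u => by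
          by_cases h : r < u <;> simp [h]
        simp_rw [h1]
        rw [setLIntegral_indicator measurableSet_Ioi, lintegral_const_mul _ hEm, ← mul_add]
        have h2 : Ioi r ∩ Ioc 0 s = Ioc r s := by
          ext u
          simp only [mem_inter_iff, mem_Ioi, mem_Ioc]
          exact ⟨fun h => ⟨h.1, h.2.2⟩, fun h => ⟨h.1, hr.1.trans h.1, h.2⟩⟩
        rw [h2]
        exact congrArg (g r * ·) (lintegral_exp_neg hc hm h0 hr.2).symm
    _ = (∫⁻ r in Ioc 0 s, g r * E s ∂μ) + ∫⁻ r in Ioc 0 s,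
          ∫⁻ u in Ioc 0 s, (Iio u).indicator (fun r => g r * E u) r ∂μ ∂μ :=
        lintegral_add_left (hg.mul_const _) _
    _ = (∫⁻ r in Icc 0 s, g r ∂μ) * E s + ∫⁻ u in Ioc 0 s,
          ∫⁻ r in Ioc 0 s, (Iio u).indicator (fun r => g r * E u) r ∂μ ∂μ := by
        congr 1
        · rw [lintegral_mul_const _ hg, setLIntegral_congr (Icc_ae_eq_Ioc_pathMeasure hc hm 0 s)]
        · refine lintegral_lintegral_swap (Measurable.aemeasurable ?_)
          have : (Function.uncurry fun r u => (Iio u).indicator (fun r => g r * E u) r) =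
              {z : ℝ≥0 × ℝ≥0 | z.1 < z.2}.indicator (fun z => g z.1 * E z.2) := by
            ext ⟨r, u⟩
            by_cases h : r < u <;> simp [h, Function.uncurry]
          rw [this]
          exact ((hg.comp measurable_fst).mul (hEm.comp measurable_snd)).indicator
            (measurableSet_lt measurable_fst measurable_snd)
    _ = _ := by
        congr 1
        refine setLIntegral_congr_fun measurableSet_Ioc fun u hu => ?_
        rw [setLIntegral_indicator measurableSet_Iio, lintegral_mul_const _ hg]
        congr 1
        refine setLIntegral_congr ?_
        have h2 : Iio u ∩ Ioc 0 s = Ioo 0 u := by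
          ext r
          simp only [mem_inter_iff, mem_Iio, mem_Ioc, mem_Ioo]
          exact ⟨fun h => ⟨h.2.1, h.1⟩, fun h => ⟨h.2, h.1, h.2.le.trans hu.2⟩⟩
        rw [h2]
        exact Ioo_ae_eq_Icc

lemma lintegral_Icc_lt_top (hc : Continuous a) (hm : Monotone a) {s : ℝ≥0} {C : ℝ}
    (hC : ∀ u ∈ Icc 0 s, |ξ u| ≤ C) {u : ℝ≥0} (hu : u ≤ s) :
    ∫⁻ r in Icc 0 u, ENNReal.ofReal (ξ r) ∂pathMeasure a < ∞ := by
  have := isFiniteMeasure_restrict_Icc hc hm 0 u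
  calc _ ≤ ∫⁻ r in Icc 0 u, ENNReal.ofReal C ∂pathMeasure a := by
        refine setLIntegral_mono' measurableSet_Icc fun r hr => ENNReal.ofReal_le_ofReal ?_
        exact (le_abs_self _).trans (hC r ⟨hr.1, hr.2.trans hu⟩)
    _ < ∞ := by
        rw [lintegral_const]
        exact ENNReal.mul_lt_top ENNReal.ofReal_lt_top (measure_lt_top _ _)

/-- If `ξ u ≤ h + ∫_{[0, u]} ξ da + f u` on `[0, s]`, then the discounted value `e^{-a s} ξ s` is
at most `h + e^{-a s} f s + ∫_{(0, s]} f e^{-a} da`. -/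
lemma exp_neg_mul_le (hc : Continuous a) (hm : Monotone a) (h0 : a 0 = 0)
    (hξm : Measurable ξ) (hξ0 : ∀ u, 0 ≤ ξ u) {s : ℝ≥0} {C D h : ℝ} (hC : ∀ u ∈ Icc 0 s, |ξ u| ≤ C)
    (hf : ∀ u, ContinuousWithinAt f (Ici u) u) (hD : ∀ u ∈ Icc 0 s, |f u| ≤ D)
    (hle : ∀ u ≤ s,
      ξ u ≤ h + (∫⁻ r in Icc 0 u, ENNReal.ofReal (ξ r) ∂pathMeasure a).toReal + f u) :
    Real.exp (-a s) * ξ s ≤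
      h + (f s * Real.exp (-a s) + ∫ u in Ioc 0 s, f u * Real.exp (-a u) ∂pathMeasure a) := by
  have hfin := isFiniteMeasure_restrict_Ioc hc hm 0 s
  set G : ℝ≥0 → ℝ≥0∞ := fun u => ∫⁻ r in Icc 0 u, ENNReal.ofReal (ξ r) ∂pathMeasure a with hG
  have hGlt : ∀ u ≤ s, G u < ∞ := fun u hu => lintegral_Icc_lt_top hc hm hC hu
  have hGmono : Monotone G := fun u v huv => lintegral_mono_set (Icc_subset_Icc_right huv)
  have hIξ : IntegrableOn (fun u => ξ u * Real.exp (-a u)) (Ioc 0 s) (pathMeasure a) := by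
    refine Integrable.of_bound (C := C)
      (hξm.mul (Real.measurable_exp.comp hc.measurable.neg)).aestronglyMeasurable ?_
    filter_upwards [ae_restrict_mem measurableSet_Ioc] with u hu
    rw [norm_mul, Real.norm_eq_abs, Real.norm_eq_abs, Real.abs_exp]
    calc |ξ u| * Real.exp (-a u) ≤ |ξ u| * 1 := by
          gcongr; exact exp_neg_le_one_of_path hm h0 u
      _ ≤ C := by linarith [hC u ⟨hu.1.le, hu.2⟩]
  have hIG : IntegrableOn (fun u => (G u).toReal * Real.exp (-a u)) (Ioc 0 s) (pathMeasure a) := by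
    refine Integrable.of_bound (C := (G s).toReal)
      (hGmono.measurable.ennreal_toReal.mul
        (Real.measurable_exp.comp hc.measurable.neg)).aestronglyMeasurable ?_
    filter_upwards [ae_restrict_mem measurableSet_Ioc] with u hu
    rw [norm_mul, Real.norm_eq_abs, Real.norm_eq_abs, Real.abs_exp, abs_of_nonneg (by positivity)]
    calc (G u).toReal * Real.exp (-a u) ≤ (G u).toReal * 1 := by
          gcongr; exact exp_neg_le_one_of_path hm h0 u
      _ ≤ (G s).toReal := by
          rw [mul_one]; exact ENNReal.toReal_mono (hGlt s le_rfl).ne (hGmono hu.2)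
  have hIf := integrableOn_mul_exp_neg hc hm h0 hf hD
  have hIe := integrableOn_exp_neg hc hm h0 0 s
  have hparts : ∫ u in Ioc 0 s, ξ u * Real.exp (-a u) ∂pathMeasure a =
      (G s).toReal * Real.exp (-a s) +
        ∫ u in Ioc 0 s, (G u).toReal * Real.exp (-a u) ∂pathMeasure a := by
    have key := lintegral_mul_exp_neg_eq hc hm h0 hξm.ennreal_ofReal s
    have e1 : ∫⁻ r in Ioc 0 s, ENNReal.ofReal (ξ r) * ENNReal.ofReal (Real.exp (-a r))
        ∂pathMeasure a = ENNReal.ofReal (∫ u in Ioc 0 s, ξ u * Real.exp (-a u) ∂pathMeasure a) := by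
      rw [ofReal_integral_eq_lintegral_ofReal hIξ (ae_of_all _ fun u => mul_nonneg (hξ0 u)
        (Real.exp_pos _).le)]
      simp_rw [ENNReal.ofReal_mul (hξ0 _)]
    have e2 : ∫⁻ r in Ioc 0 s, G r * ENNReal.ofReal (Real.exp (-a r))
        ∂pathMeasure a =
        ENNReal.ofReal (∫ u in Ioc 0 s, (G u).toReal * Real.exp (-a u) ∂pathMeasure a) := by
      rw [ofReal_integral_eq_lintegral_ofReal hIG (ae_of_all _ fun u => mul_nonneg
        ENNReal.toReal_nonneg (Real.exp_pos _).le)]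
      refine setLIntegral_congr_fun measurableSet_Ioc fun u hu => ?_
      rw [ENNReal.ofReal_mul ENNReal.toReal_nonneg, ENNReal.ofReal_toReal (hGlt u hu.2).ne]
    have e3 : G s * ENNReal.ofReal (Real.exp (-a s)) =
        ENNReal.ofReal ((G s).toReal * Real.exp (-a s)) := by
      rw [ENNReal.ofReal_mul ENNReal.toReal_nonneg, ENNReal.ofReal_toReal (hGlt s le_rfl).ne]
    have hpos2 : 0 ≤ ∫ u in Ioc 0 s, (G u).toReal * Real.exp (-a u) ∂pathMeasure a :=
      integral_nonneg fun u => mul_nonneg ENNReal.toReal_nonneg (Real.exp_pos _).le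
    have hpos3 : 0 ≤ (G s).toReal * Real.exp (-a s) := by positivity
    rw [e1, e2, e3, ← ENNReal.ofReal_add hpos3 hpos2] at key
    refine (ENNReal.ofReal_eq_ofReal_iff ?_ (add_nonneg hpos3 hpos2)).1 key
    exact integral_nonneg fun u => mul_nonneg (hξ0 u) (Real.exp_pos _).le
  -- The hypothesis integrated against `e^{-a} da`. Its `G` integral cancels the one in `hparts`,
  -- which bounds `G s * e^{-a s}`; the two multiples of `h` then add up to `h`.
  have hcmp : ∫ u in Ioc 0 s, ξ u * Real.exp (-a u) ∂pathMeasure a ≤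
      h * (1 - Real.exp (-a s)) + (∫ u in Ioc 0 s, (G u).toReal * Real.exp (-a u) ∂pathMeasure a)
        + ∫ u in Ioc 0 s, f u * Real.exp (-a u) ∂pathMeasure a := by
    have e1 : h * (1 - Real.exp (-a s)) =
        ∫ u in Ioc 0 s, h * Real.exp (-a u) ∂pathMeasure a := by
      rw [integral_const_mul, integral_exp_neg hc hm h0 (zero_le (a := s)), h0, neg_zero,
        Real.exp_zero]
    have hsum : IntegrableOn (fun u => h * Real.exp (-a u) + (G u).toReal * Real.exp (-a u))
        (Ioc 0 s) (pathMeasure a) := (hIe.const_mul h).add hIG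
    rw [e1, ← integral_add (hIe.const_mul h) hIG, ← integral_add hsum hIf]
    refine setIntegral_mono_on hIξ (hsum.add hIf) measurableSet_Ioc
      fun u hu => ?_
    have := mul_le_mul_of_nonneg_right (hle u hu.2) (Real.exp_pos (-a u)).le
    linarith
  have hs := mul_le_mul_of_nonneg_right (hle s le_rfl) (Real.exp_pos (-a s)).le
  change ξ s * _ ≤ (h + (G s).toReal + f s) * _ at hs
  linarith

end Gronwall

/-! ### Riemann sums of a martingale against a bounded monotone adapted process -/

section Martingale

variable {Ω : Type*} {mΩ : MeasurableSpace Ω} {P : Measure Ω}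
  {𝓕 : Filtration ℝ≥0 mΩ} {Y W : ℝ≥0 → Ω → ℝ}

lemma integral_mul_condExp [IsProbabilityMeasure P]
    {m : MeasurableSpace Ω} (hm : m ≤ mΩ) {f g : Ω → ℝ}
    (hf : StronglyMeasurable[m] f) (hg : Integrable g P) {c : ℝ} (hc : ∀ᵐ ω ∂P, ‖f ω‖ ≤ c)
    {B : Set Ω} (hB : MeasurableSet[m] B) :
    ∫ ω in B, f ω * (P[g | m]) ω ∂P = ∫ ω in B, f ω * g ω ∂P := by
  have h1 := condExp_stronglyMeasurable_mul_of_bound hm hf hg c hc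
  have h2 : Integrable (f * g) P := hg.bdd_mul (hf.mono hm).aestronglyMeasurable hc
  rw [← setIntegral_condExp hm (f := fun ω => f ω * g ω) h2 hB]
  exact setIntegral_congr_ae (hm _ hB) (h1.mono fun ω h _ => h.symm)

/-- From `|Y s| ≤ E[|Y T| | 𝓕 s]` and `|y| ≤ K + (|y| - K)⁺`: a bounded part plus a part whose
expectation is small for large `K`. -/
lemma abs_le_add_condExp [IsProbabilityMeasure P]
    (hY : Martingale Y 𝓕 P) {K : ℝ} {s T : ℝ≥0} (hs : s ≤ T) :
    ∀ᵐ ω ∂P, |Y s ω| ≤ K + (P[fun ω => max (|Y T ω| - K) 0 | 𝓕 s]) ω := by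
  have hint : Integrable (fun ω => max (|Y T ω| - K) 0) P :=
    ((hY.integrable T).abs.sub (integrable_const K)).pos_part
  have h2 : P[fun ω => |Y T ω| | 𝓕 s] ≤ᵐ[P] P[(fun _ => K) + (fun ω => max (|Y T ω| - K) 0) | 𝓕 s] :=
    condExp_mono (hY.integrable T).abs ((integrable_const K).add hint)
      (ae_of_all _ fun ω => by
        have := le_max_left (|Y T ω| - K) 0
        simp only [Pi.add_apply]; linarith)
  have h3 := condExp_add (m := 𝓕 s) (integrable_const K) hint
  filter_upwards [abs_condExp_ae_le_condExp_abs (m := 𝓕 s) (μ := P) (Y T), h2, h3,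
    hY.condExp_ae_eq hs] with ω h1 h2 h3 h4
  rw [Pi.abs_apply, h4] at h1
  rw [h3, Pi.add_apply, condExp_const (𝓕.le s)] at h2
  exact h1.trans h2

/-- The sum `∑ Y (r (i + 1)) (W (r i) - W (r (i + 1)))` over the first `m` cells of a partition. -/
noncomputable def rightSum (Y W : ℝ≥0 → Ω → ℝ) (r : ℕ → ℝ≥0) (m : ℕ) (ω : Ω) : ℝ :=
  ∑ i ∈ Finset.range m, Y (r (i + 1)) ω * (W (r i) ω - W (r (i + 1)) ω)

lemma ae_norm_weight_le_one (hW01 : ∀ᵐ ω ∂P, ∀ u, 0 ≤ W u ω ∧ W u ω ≤ 1)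
    (u : ℝ≥0) : ∀ᵐ ω ∂P, ‖W u ω‖ ≤ 1 := by
  filter_upwards [hW01] with ω h
  rw [Real.norm_eq_abs, abs_of_nonneg (h u).1]
  exact (h u).2

lemma ae_norm_weight_sub_le_one (hW01 : ∀ᵐ ω ∂P, ∀ u, 0 ≤ W u ω ∧ W u ω ≤ 1)
    (u v : ℝ≥0) : ∀ᵐ ω ∂P, ‖W u ω - W v ω‖ ≤ 1 := by
  filter_upwards [hW01] with ω h
  rw [Real.norm_eq_abs, abs_le]
  constructor <;> linarith [(h u).1, (h u).2, (h v).1, (h v).2]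

lemma integrable_mul_weight_sub (hY : Martingale Y 𝓕 P) (hW : StronglyAdapted 𝓕 W)
    (hW01 : ∀ᵐ ω ∂P, ∀ u, 0 ≤ W u ω ∧ W u ω ≤ 1) (u v w : ℝ≥0) :
    Integrable (fun ω => Y u ω * (W v ω - W w ω)) P := by
  have hv : StronglyMeasurable (W v) := (hW v).mono (𝓕.le v)
  have hw : StronglyMeasurable (W w) := (hW w).mono (𝓕.le w)
  exact (hY.integrable u).mul_bdd (hv.sub hw).aestronglyMeasurable
    (ae_norm_weight_sub_le_one hW01 v w)

lemma integrable_rightSum (hY : Martingale Y 𝓕 P) (hW : StronglyAdapted 𝓕 W)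
    (hW01 : ∀ᵐ ω ∂P, ∀ u, 0 ≤ W u ω ∧ W u ω ≤ 1)
    (r : ℕ → ℝ≥0) (m : ℕ) : Integrable (rightSum Y W r m) P :=
  integrable_finsetSum _ fun _ _ => integrable_mul_weight_sub hY hW hW01 _ _ _

/-- The weights are nonnegative with sum at most `1`, so the constant parts contribute at most `K`.
The remaining parts are conditional expectations of one variable `Z`, and integrating them against
the weights costs at most `E Z`, whatever the partition. -/
lemma setIntegral_abs_rightSum_le [IsProbabilityMeasure P]
    (hY : Martingale Y 𝓕 P) (hW : StronglyAdapted 𝓕 W)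
    (hW01 : ∀ᵐ ω ∂P, ∀ u, 0 ≤ W u ω ∧ W u ω ≤ 1)
    (hWanti : ∀ᵐ ω ∂P, Antitone (fun u => W u ω))
    {r : ℕ → ℝ≥0} (hr : Monotone r) {T : ℝ≥0} {m : ℕ}
    (hT : r m ≤ T) {K : ℝ} (hK : 0 ≤ K) {E : Set Ω} :
    ∫ ω in E, |rightSum Y W r m ω| ∂P ≤ K * P.real E + ∫ ω, max (|Y T ω| - K) 0 ∂P := by
  set Z : Ω → ℝ := fun ω => max (|Y T ω| - K) 0 with hZ
  have hZi : Integrable Z P := ((hY.integrable T).abs.sub (integrable_const K)).pos_part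
  set Δ : ℕ → Ω → ℝ := fun i ω => W (r i) ω - W (r (i + 1)) ω with hΔ
  -- Each weight is known at the right endpoint, where `Y` is sampled, so the conditional
  -- expectation can later be dropped.
  have hΔm : ∀ i, StronglyMeasurable[𝓕 (r (i + 1))] (Δ i) := fun i =>
    ((hW _).mono (𝓕.mono (hr (Nat.le_succ i)))).sub (hW _)
  have hΔ1 : ∀ i, ∀ᵐ ω ∂P, ‖Δ i ω‖ ≤ 1 := fun i => ae_norm_weight_sub_le_one hW01 _ _
  have hΔsum : ∀ᵐ ω ∂P, ∑ i ∈ Finset.range m, Δ i ω ≤ 1 := by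
    filter_upwards [hW01] with ω h
    simp only [hΔ, Finset.sum_range_sub' (fun i => W (r i) ω)]
    linarith [(h (r 0)).2, (h (r m)).1]
  set Q : Ω → ℝ := fun ω => ∑ i ∈ Finset.range m, Δ i ω * (P[Z | 𝓕 (r (i + 1))]) ω with hQ
  have hQi' : ∀ i, Integrable (fun ω => Δ i ω * (P[Z | 𝓕 (r (i + 1))]) ω) P := fun i =>
    integrable_condExp.bdd_mul ((hΔm i).mono (𝓕.le _)).aestronglyMeasurable (hΔ1 i)
  have hQi : Integrable Q P := integrable_finsetSum _ fun i _ => hQi' i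
  have hΔ0 : ∀ᵐ ω ∂P, ∀ i, 0 ≤ Δ i ω := by
    filter_upwards [hWanti] with ω h i
    exact sub_nonneg.2 (h (hr (Nat.le_succ i)))
  have hce0 : ∀ᵐ ω ∂P, ∀ i, 0 ≤ (P[Z | 𝓕 (r (i + 1))]) ω :=
    ae_all_iff.2 fun i => condExp_nonneg (ae_of_all _ fun ω => le_max_right _ _)
  have hQ0 : 0 ≤ᵐ[P] Q := by
    filter_upwards [hΔ0, hce0] with ω h1 h2
    exact Finset.sum_nonneg fun i _ => mul_nonneg (h1 i) (h2 i)
  have hbd : ∀ᵐ ω ∂P, ∀ i ∈ Finset.range m,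
      |Y (r (i + 1)) ω| ≤ K + (P[Z | 𝓕 (r (i + 1))]) ω := by
    refine ae_all_iff.2 fun i => ?_
    by_cases hi : i ∈ Finset.range m
    · have := Finset.mem_range.1 hi
      filter_upwards [abs_le_add_condExp hY (K := K) ((hr (show i + 1 ≤ m from this)).trans hT)]
        with ω h _ using h
    · exact ae_of_all _ fun ω h => absurd h hi
  have hle : ∀ᵐ ω ∂P, |rightSum Y W r m ω| ≤ K + Q ω := by
    filter_upwards [hΔsum, hΔ0, hbd] with ω h1 h2 h3
    calc |rightSum Y W r m ω| ≤ ∑ i ∈ Finset.range m, |Y (r (i + 1)) ω * Δ i ω| :=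
          Finset.abs_sum_le_sum_abs _ _
      _ ≤ ∑ i ∈ Finset.range m, (K * Δ i ω + Δ i ω * (P[Z | 𝓕 (r (i + 1))]) ω) := by
          refine Finset.sum_le_sum fun i hi => ?_
          rw [abs_mul, abs_of_nonneg (h2 i)]
          have := mul_le_mul_of_nonneg_right (h3 i hi) (h2 i)
          linarith
      _ = K * ∑ i ∈ Finset.range m, Δ i ω + Q ω := by
          rw [Finset.sum_add_distrib, Finset.mul_sum]
      _ ≤ K + Q ω := by linarith [mul_le_mul_of_nonneg_left h1 hK]
  calc ∫ ω in E, |rightSum Y W r m ω| ∂P ≤ ∫ ω in E, (K + Q ω) ∂P :=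
        setIntegral_mono_ae (integrable_rightSum hY hW hW01 r m).abs.integrableOn
          ((integrable_const K).add hQi).integrableOn hle
    _ = K * P.real E + ∫ ω in E, Q ω ∂P := by
        rw [integral_add (integrable_const K) hQi.integrableOn]
        simp [mul_comm]
    -- `E` need not belong to the filtration, so the integral is enlarged to the whole space before
    -- conditioning is undone.
    _ ≤ K * P.real E + ∫ ω, Q ω ∂P := by
        exact add_le_add_right (setIntegral_le_integral hQi hQ0) _
    _ = K * P.real E + ∫ ω, ∑ i ∈ Finset.range m, Δ i ω * Z ω ∂P := by
        congr 1
        rw [integral_finsetSum _ fun i _ => hQi' i, integral_finsetSum _ fun i _ =>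
          hZi.bdd_mul ((hΔm i).mono (𝓕.le _)).aestronglyMeasurable (hΔ1 i)]
        refine Finset.sum_congr rfl fun i _ => ?_
        have := integral_mul_condExp (𝓕.le _) (hΔm i) hZi (hΔ1 i) MeasurableSet.univ
        simpa only [Measure.restrict_univ] using this
    _ ≤ K * P.real E + ∫ ω, Z ω ∂P := by
        refine add_le_add_right ?_ _
        refine integral_mono_ae (integrable_finsetSum _ fun i _ =>
          hZi.bdd_mul ((hΔm i).mono (𝓕.le _)).aestronglyMeasurable (hΔ1 i)) hZi ?_
        filter_upwards [hΔsum] with ω h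
        rw [← Finset.sum_mul]
        have hz : 0 ≤ Z ω := le_max_right _ _
        nlinarith

lemma tendsto_integral_excess [IsProbabilityMeasure P] {X : Ω → ℝ} (hX : Integrable X P) :
    Tendsto (fun K : ℕ => ∫ ω, max (|X ω| - K) 0 ∂P) atTop (𝓝 0) := by
  have h : Tendsto (fun K : ℕ => ∫ ω, max (|X ω| - K) 0 ∂P) atTop (𝓝 (∫ _, (0 : ℝ) ∂P)) := by
    refine tendsto_integral_of_dominated_convergence (fun ω => |X ω|)
      (fun K => (hX.abs.sub (integrable_const _)).pos_part.aestronglyMeasurable) hX.abs ?_ ?_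
    · refine fun K => ae_of_all _ fun ω => ?_
      rw [Real.norm_eq_abs, abs_of_nonneg (le_max_right _ _)]
      have : (0 : ℝ) ≤ K := Nat.cast_nonneg K
      exact max_le (by linarith) (abs_nonneg _)
    · refine ae_of_all _ fun ω => tendsto_const_nhds.congr' ?_
      filter_upwards [eventually_ge_atTop ⌈|X ω|⌉₊] with K hK
      have : |X ω| ≤ K := (Nat.le_ceil _).trans (by exact_mod_cast hK)
      rw [max_eq_right (by linarith)]
  simpa using h

lemma uniformIntegrable_rightSum [IsProbabilityMeasure P]
    (hY : Martingale Y 𝓕 P) (hW : StronglyAdapted 𝓕 W)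
    (hW01 : ∀ᵐ ω ∂P, ∀ u, 0 ≤ W u ω ∧ W u ω ≤ 1)
    (hWanti : ∀ᵐ ω ∂P, Antitone (fun u => W u ω))
    {r : ℕ → ℕ → ℝ≥0} (hr : ∀ n, Monotone (r n)) {T : ℝ≥0} {m : ℕ → ℕ}
    (hT : ∀ n, r n (m n) ≤ T) : UniformIntegrable (fun n => rightSum Y W (r n) (m n)) 1 P := by
  have hnorm : ∀ n {E : Set Ω}, MeasurableSet E →
      eLpNorm (E.indicator (rightSum Y W (r n) (m n))) 1 P =
        ENNReal.ofReal (∫ ω in E, |rightSum Y W (r n) (m n) ω| ∂P) := by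
    intro n E hE
    rw [eLpNorm_indicator_eq_eLpNorm_restrict hE, eLpNorm_one_eq_lintegral_enorm,
      ← ofReal_integral_norm_eq_lintegral_enorm
        (integrable_rightSum hY hW hW01 (r n) (m n)).integrableOn]
    rfl
  refine ⟨fun n => (integrable_rightSum hY hW hW01 _ _).aestronglyMeasurable, ?_, ?_⟩
  · intro ε hε
    have hev := (tendsto_integral_excess (hY.integrable T)).eventually (gt_mem_nhds (half_pos hε))
    obtain ⟨K, hK⟩ := hev.exists
    -- `K + 1` rather than `K`, since `K` may be `0`.
    refine ⟨ε / (2 * (K + 1)), by positivity, fun n E hE hPE => ?_⟩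
    rw [hnorm n hE]
    refine ENNReal.ofReal_le_ofReal ?_
    refine (setIntegral_abs_rightSum_le hY hW hW01 hWanti (hr n) (hT n)
      (Nat.cast_nonneg K)).trans ?_
    have h1 : P.real E ≤ ε / (2 * (K + 1)) :=
      ENNReal.toReal_le_of_le_ofReal (by positivity) hPE
    have h2 : (K : ℝ) * P.real E ≤ ε / 2 := by
      calc (K : ℝ) * P.real E ≤ (K + 1) * (ε / (2 * (K + 1))) := by
            gcongr; linarith
        _ = ε / 2 := by field_simp
    linarith
  · refine ⟨(∫ ω, max (|Y T ω| - 0) 0 ∂P).toNNReal, fun n => ?_⟩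
    have h := hnorm n MeasurableSet.univ
    rw [indicator_univ] at h
    rw [h]
    refine ENNReal.ofReal_le_ofReal ?_
    simpa using setIntegral_abs_rightSum_le hY hW hW01 hWanti (hr n) (hT n) le_rfl (E := univ)

/-- Against the `𝓕 (r i)`-measurable factor `W (r i)`, the value `Y (r (i + 1))` can be replaced by
`Y (r i)`; the sum then telescopes. -/
lemma setIntegral_rightSum [IsProbabilityMeasure P]
    (hY : Martingale Y 𝓕 P) (hW : StronglyAdapted 𝓕 W)
    (hW01 : ∀ᵐ ω ∂P, ∀ u, 0 ≤ W u ω ∧ W u ω ≤ 1)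
    {r : ℕ → ℝ≥0} (hr : Monotone r) (m : ℕ) {B : Set Ω}
    (hB : MeasurableSet[𝓕 (r 0)] B) :
    ∫ ω in B, rightSum Y W r m ω ∂P =
      (∫ ω in B, Y (r 0) ω * W (r 0) ω ∂P) - ∫ ω in B, Y (r m) ω * W (r m) ω ∂P := by
  have hi : ∀ u v, Integrable (fun ω => Y u ω * W v ω) P := fun u v =>
    (hY.integrable u).mul_bdd ((hW v).mono (𝓕.le v)).aestronglyMeasurable
      (ae_norm_weight_le_one hW01 v)
  have hterm : ∀ i, ∫ ω in B, Y (r (i + 1)) ω * (W (r i) ω - W (r (i + 1)) ω) ∂P =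
      (∫ ω in B, Y (r i) ω * W (r i) ω ∂P) -
        ∫ ω in B, Y (r (i + 1)) ω * W (r (i + 1)) ω ∂P := by
    intro i
    have hB' : MeasurableSet[𝓕 (r i)] B := 𝓕.mono (hr (Nat.zero_le i)) _ hB
    simp_rw [mul_sub]
    rw [integral_sub (hi (r (i + 1)) (r i)).integrableOn
      (hi (r (i + 1)) (r (i + 1))).integrableOn]
    congr 1
    simp_rw [mul_comm (Y _ _)]
    rw [← integral_mul_condExp (𝓕.le _) (hW _) (hY.integrable (r (i + 1)))
      (ae_norm_weight_le_one hW01 _) hB']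
    refine setIntegral_congr_ae (𝓕.le _ _ hB') ?_
    filter_upwards [hY.condExp_ae_eq (hr (Nat.le_succ i))] with ω h _
    rw [← h]
  unfold rightSum
  rw [integral_finsetSum _ fun i _ => (integrable_mul_weight_sub hY hW hW01 _ _ _).integrableOn]
  simp_rw [hterm]
  exact Finset.sum_range_sub' (fun i => ∫ ω in B, Y (r i) ω * W (r i) ω ∂P) m

end Martingale

/-! ### The discounted martingale -/

section Discounted

variable {Ω : Type*} {mΩ : MeasurableSpace Ω} {P : Measure Ω}
  {𝓕 : Filtration ℝ≥0 mΩ} {Y A : ℝ≥0 → Ω → ℝ}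

/-- The process `e^{-A} Y + ∫ Y e^{-A} dA`, which is `Y 0 + ∫ e^{-A} dY` by integration by parts. -/
noncomputable def discounted (Y A : ℝ≥0 → Ω → ℝ) (s : ℝ≥0) (ω : Ω) : ℝ :=
  Y s ω * Real.exp (-A s ω) +
    ∫ u in Ioc 0 s, Y u ω * Real.exp (-A u ω) ∂pathMeasure (fun v => A v ω)

/-- Standing assumptions on the pair formed by a martingale and a continuous nondecreasing
process. -/
structure IsDiscountPair (Y A : ℝ≥0 → Ω → ℝ) (𝓕 : Filtration ℝ≥0 mΩ) (P : Measure Ω) : Prop where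
  martingale : Martingale Y 𝓕 P
  rightCont : ∀ᵐ ω ∂P, ∀ u, ContinuousWithinAt (fun v => Y v ω) (Ici u) u
  bounded : ∀ᵐ ω ∂P, ∀ t, ∃ C, ∀ u ∈ Icc 0 t, |Y u ω| ≤ C
  adapted : StronglyAdapted 𝓕 A
  cont : ∀ᵐ ω ∂P, Continuous (fun t => A t ω)
  mono : ∀ᵐ ω ∂P, Monotone (fun t => A t ω)
  zero : ∀ᵐ ω ∂P, A 0 ω = 0

namespace IsDiscountPair

lemma stronglyAdapted_exp (h : IsDiscountPair Y A 𝓕 P) :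
    StronglyAdapted 𝓕 (fun u ω => Real.exp (-A u ω)) := fun u =>
  Real.continuous_exp.comp_stronglyMeasurable (h.adapted u).neg

lemma exp_mem_Icc (h : IsDiscountPair Y A 𝓕 P) :
    ∀ᵐ ω ∂P, ∀ u, 0 ≤ Real.exp (-A u ω) ∧ Real.exp (-A u ω) ≤ 1 := by
  filter_upwards [h.mono, h.zero] with ω h1 h2 u
  exact ⟨(Real.exp_pos _).le, exp_neg_le_one_of_path h1 h2 u⟩

lemma antitone_exp (h : IsDiscountPair Y A 𝓕 P) :
    ∀ᵐ ω ∂P, Antitone (fun u => Real.exp (-A u ω)) := by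
  filter_upwards [h.mono] with ω h1 u v huv
  exact Real.exp_le_exp.2 (neg_le_neg (h1 huv))

lemma ae_tendsto_rightSum (h : IsDiscountPair Y A 𝓕 P) {x y : ℝ≥0} (hxy : x ≤ y) :
    ∀ᵐ ω ∂P, Tendsto
      (fun n => rightSum Y (fun u ω => Real.exp (-A u ω)) (gridPoint x y n) (n + 1) ω) atTop
      (𝓝 (∫ u in Ioc x y, Y u ω * Real.exp (-A u ω) ∂pathMeasure (fun v => A v ω))) := by
  filter_upwards [h.cont, h.mono, h.zero, h.rightCont, h.bounded] with ω hc hm h0 hr hb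
  obtain ⟨C, hC⟩ := hb y
  exact tendsto_riemannSum hc hm h0 hr (fun u hu => hC u ⟨zero_le, hu.2⟩) hxy

lemma integrable_integral [IsProbabilityMeasure P]
    (h : IsDiscountPair Y A 𝓕 P) {x y : ℝ≥0} (hxy : x ≤ y) :
    Integrable (fun ω => ∫ u in Ioc x y, Y u ω * Real.exp (-A u ω) ∂pathMeasure (fun v => A v ω))
      P :=
  memLp_one_iff_integrable.1 <| (uniformIntegrable_rightSum h.martingale h.stronglyAdapted_exp
    h.exp_mem_Icc h.antitone_exp (gridPoint_mono x y)
    (fun n => (gridPoint_last hxy n).le)).memLp_of_ae_tendsto (h.ae_tendsto_rightSum hxy)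

/-- Almost sure convergence and uniform integrability give convergence in `L¹` (Vitali), which
carries the identity for Riemann sums over to the integral. -/
lemma setIntegral_integral [IsProbabilityMeasure P]
    (h : IsDiscountPair Y A 𝓕 P) {x y : ℝ≥0} (hxy : x ≤ y) {B : Set Ω}
    (hB : MeasurableSet[𝓕 x] B) :
    ∫ ω in B, (∫ u in Ioc x y, Y u ω * Real.exp (-A u ω) ∂pathMeasure (fun v => A v ω)) ∂P =
      (∫ ω in B, Y x ω * Real.exp (-A x ω) ∂P) - ∫ ω in B, Y y ω * Real.exp (-A y ω) ∂P := by
  have hui := uniformIntegrable_rightSum h.martingale h.stronglyAdapted_exp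
    h.exp_mem_Icc h.antitone_exp (gridPoint_mono x y) (fun n => (gridPoint_last hxy n).le)
  have hint := h.integrable_integral hxy
  have hL1 := tendsto_Lp_finite_of_tendsto_ae le_rfl ENNReal.one_ne_top hui.1
    (memLp_one_iff_integrable.2 hint) hui.2.1 (h.ae_tendsto_rightSum hxy)
  have hlim := tendsto_setIntegral_of_L1' _ hint.aestronglyMeasurable
    (Eventually.of_forall fun n => integrable_rightSum h.martingale h.stronglyAdapted_exp
      h.exp_mem_Icc (gridPoint x y n) (n + 1)) hL1 B
  refine tendsto_nhds_unique hlim (tendsto_const_nhds.congr fun n => ?_)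
  have := setIntegral_rightSum h.martingale h.stronglyAdapted_exp h.exp_mem_Icc
    (gridPoint_mono x y n) (n + 1) (B := B) (by rwa [gridPoint_zero])
  rw [this, gridPoint_zero, gridPoint_last hxy]

lemma integrable_mul_exp [IsProbabilityMeasure P] (h : IsDiscountPair Y A 𝓕 P) (s : ℝ≥0) :
    Integrable (fun ω => Y s ω * Real.exp (-A s ω)) P :=
  (h.martingale.integrable s).mul_bdd ((h.stronglyAdapted_exp s).mono (𝓕.le s)).aestronglyMeasurable
    (ae_norm_weight_le_one h.exp_mem_Icc s)

lemma integrable_discounted [IsProbabilityMeasure P] (h : IsDiscountPair Y A 𝓕 P) (s : ℝ≥0) :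
    Integrable (discounted Y A s) P :=
  (h.integrable_mul_exp s).add (h.integrable_integral zero_le)

lemma ae_discounted_eq (h : IsDiscountPair Y A 𝓕 P) {x y : ℝ≥0} (hxy : x ≤ y) :
    ∀ᵐ ω ∂P, discounted Y A y ω = discounted Y A x ω +
      (Y y ω * Real.exp (-A y ω) - Y x ω * Real.exp (-A x ω) +
      ∫ u in Ioc x y, Y u ω * Real.exp (-A u ω) ∂pathMeasure (fun v => A v ω)) := by
  filter_upwards [h.cont, h.mono, h.zero, h.rightCont, h.bounded] with ω hc hm h0 hr hb
  obtain ⟨C, hC⟩ := hb y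
  have hI := integrableOn_mul_exp_neg hc hm h0 hr hC
  have hsplit : Ioc 0 y = Ioc 0 x ∪ Ioc x y := (Ioc_union_Ioc_eq_Ioc zero_le hxy).symm
  rw [discounted, discounted, hsplit, setIntegral_union (Ioc_disjoint_Ioc_of_le le_rfl)
    measurableSet_Ioc (hI.mono_set (Ioc_subset_Ioc_right hxy))
    (hI.mono_set (Ioc_subset_Ioc_left zero_le))]
  ring

/-- The discounted process has the martingale property. -/
lemma setIntegral_discounted [IsProbabilityMeasure P]
    (h : IsDiscountPair Y A 𝓕 P) {x y : ℝ≥0} (hxy : x ≤ y) {B : Set Ω}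
    (hB : MeasurableSet[𝓕 x] B) :
    ∫ ω in B, discounted Y A x ω ∂P = ∫ ω in B, discounted Y A y ω ∂P := by
  have h1 := h.integrable_mul_exp x
  have h2 := h.integrable_mul_exp y
  have h3 := h.integrable_integral hxy
  have hd : Integrable (fun ω => Y y ω * Real.exp (-A y ω) - Y x ω * Real.exp (-A x ω)) P :=
    h2.sub h1
  have he : Integrable (fun ω => Y y ω * Real.exp (-A y ω) - Y x ω * Real.exp (-A x ω) +
      ∫ u in Ioc x y, Y u ω * Real.exp (-A u ω) ∂pathMeasure (fun v => A v ω)) P := hd.add h3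
  rw [setIntegral_congr_ae (𝓕.le _ _ hB) ((h.ae_discounted_eq hxy).mono fun ω hω _ => hω),
    integral_add (h.integrable_discounted x).integrableOn he.integrableOn,
    integral_add hd.integrableOn h3.integrableOn, integral_sub h2.integrableOn h1.integrableOn,
    h.setIntegral_integral hxy hB]
  ring

lemma integral_discounted [IsProbabilityMeasure P]
    (h : IsDiscountPair Y A 𝓕 P) (hY0 : ∀ᵐ ω ∂P, Y 0 ω = 0) (s : ℝ≥0) :
    ∫ ω, discounted Y A s ω ∂P = 0 := by
  have h1 := h.setIntegral_discounted (zero_le (a := s)) MeasurableSet.univ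
  simp only [Measure.restrict_univ] at h1
  rw [← h1, integral_eq_zero_of_ae]
  filter_upwards [hY0] with ω hω
  simp [discounted, hω]

end IsDiscountPair

end Discounted

/-! ### The maximal inequality along a finite sequence of times -/

section Maximal

variable {Ω : Type*} {mΩ : MeasurableSpace Ω} {P : Measure Ω}
  {𝓕 : Filtration ℝ≥0 mΩ} {Y A ξ : ℝ≥0 → Ω → ℝ} {H : Ω → ℝ} {t : ℝ≥0} {r : ℕ → ℝ≥0}

/-- Since `B i` belongs to `𝓕 (r i)`, the discounted process can be moved there from `r i` to `t`.
All pieces then integrate the same nonnegative variable over disjoint sets. `H` is the same at all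
times, so it needs no adaptedness. -/
lemma sum_lintegral_discounted_le [IsProbabilityMeasure P] (h : IsDiscountPair Y A 𝓕 P)
    (hY0 : ∀ᵐ ω ∂P, Y 0 ω = 0)
    (hH : Integrable H P) (hξ0 : ∀ᵐ ω ∂P, ∀ s, 0 ≤ ξ s ω) {m : ℕ} (hrt : ∀ i < m, r i ≤ t)
    {B : ℕ → Set Ω} (hB : ∀ i, MeasurableSet[𝓕 (r i)] (B i))
    (hdisj : Pairwise (Function.onFun Disjoint B))
    (hle : ∀ i < m, ∀ᵐ ω ∂P, ω ∈ B i →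
      Real.exp (-A (r i) ω) * ξ (r i) ω ≤ H ω + discounted Y A (r i) ω)
    (hge : ∀ᵐ ω ∂P, 0 ≤ H ω + discounted Y A t ω) :
    ∑ i ∈ Finset.range m, ∫⁻ ω in B i, ENNReal.ofReal (Real.exp (-A (r i) ω) * ξ (r i) ω) ∂P ≤
      ENNReal.ofReal (∫ ω, H ω ∂P) := by
  have hBm : ∀ i, MeasurableSet (B i) := fun i => 𝓕.le _ _ (hB i)
  have hint : ∀ s, Integrable (fun ω => H ω + discounted Y A s ω) P := fun s =>
    hH.add (h.integrable_discounted s)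
  have hterm : ∀ i ∈ Finset.range m,
      ∫⁻ ω in B i, ENNReal.ofReal (Real.exp (-A (r i) ω) * ξ (r i) ω) ∂P ≤
      ENNReal.ofReal (∫ ω in B i, (H ω + discounted Y A t ω) ∂P) := by
    intro i hi
    have him := Finset.mem_range.1 hi
    have e1 : ∫ ω in B i, (H ω + discounted Y A t ω) ∂P =
        ∫ ω in B i, (H ω + discounted Y A (r i) ω) ∂P := by
      rw [integral_add hH.integrableOn (h.integrable_discounted t).integrableOn,
        integral_add hH.integrableOn (h.integrable_discounted (r i)).integrableOn,
        h.setIntegral_discounted (hrt i him) (hB i)]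
    have hle' : ∀ᵐ ω ∂(P.restrict (B i)),
        Real.exp (-A (r i) ω) * ξ (r i) ω ≤ H ω + discounted Y A (r i) ω :=
      (ae_restrict_iff' (hBm i)).2 (hle i him)
    rw [e1, ofReal_integral_eq_lintegral_ofReal (hint (r i)).integrableOn]
    · exact lintegral_mono_ae (hle'.mono fun ω hω => ENNReal.ofReal_le_ofReal hω)
    · filter_upwards [hle', ae_restrict_of_ae hξ0] with ω h1 h2
      exact (mul_nonneg (Real.exp_pos _).le (h2 _)).trans h1
  calc _ ≤ ∑ i ∈ Finset.range m, ENNReal.ofReal (∫ ω in B i, (H ω + discounted Y A t ω) ∂P) :=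
        Finset.sum_le_sum hterm
    _ = ENNReal.ofReal (∑ i ∈ Finset.range m, ∫ ω in B i, (H ω + discounted Y A t ω) ∂P) :=
        (ENNReal.ofReal_sum_of_nonneg fun i _ =>
          integral_nonneg_of_ae (ae_restrict_of_ae hge)).symm
    _ = ENNReal.ofReal (∫ ω in ⋃ i ∈ Finset.range m, B i, (H ω + discounted Y A t ω) ∂P) := by
        rw [integral_biUnion_finset _ (fun i _ => hBm i) (fun i _ j _ hij => hdisj hij)
          (fun i _ => (hint t).integrableOn)]
    _ ≤ ENNReal.ofReal (∫ ω, (H ω + discounted Y A t ω) ∂P) :=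
        ENNReal.ofReal_le_ofReal (setIntegral_le_integral (hint t) hge)
    _ = ENNReal.ofReal (∫ ω, H ω ∂P) := by
        rw [integral_add hH (h.integrable_discounted t), h.integral_discounted hY0, add_zero]

/-- On the union `e^{-A t} c ≤ Z`, because `A` is largest at `t`. Hence `c ^ p ≤ e^{p A t} Z ^ p`
there, and Hölder with exponents `1 / (1 - p)` and `1 / p` separates the factors. -/
lemma rpow_mul_measure_le_of_sum_le (hA : ∀ s, Measurable (A s)) (hξ : ∀ s, Measurable (ξ s))
    (hmono : ∀ᵐ ω ∂P, Monotone (fun s => A s ω))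
    {m : ℕ} (hrt : ∀ i < m, r i ≤ t) {B : ℕ → Set Ω} (hB : ∀ i, MeasurableSet (B i))
    {c p : ℝ} (hc : 0 ≤ c) (hp0 : 0 < p) (hp1 : p < 1)
    (hBc : ∀ i, ∀ ω ∈ B i, c ≤ ξ (r i) ω) {κ : ℝ≥0∞}
    (hκ : ∑ i ∈ Finset.range m, ∫⁻ ω in B i, ENNReal.ofReal (Real.exp (-A (r i) ω) * ξ (r i) ω) ∂P
      ≤ κ) :
    ENNReal.ofReal (c ^ p) * P (⋃ i ∈ Finset.range m, B i) ≤
      (∫⁻ ω, ENNReal.ofReal (Real.exp (p * A t ω / (1 - p))) ∂P) ^ (1 - p) * κ ^ p := by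
  set Z : Ω → ℝ≥0∞ := fun ω => ∑ i ∈ Finset.range m,
    (B i).indicator (fun ω => ENNReal.ofReal (Real.exp (-A (r i) ω) * ξ (r i) ω)) ω with hZ
  have hfm : ∀ i, Measurable (fun ω => ENNReal.ofReal (Real.exp (-A (r i) ω) * ξ (r i) ω)) :=
    fun i => ((Real.measurable_exp.comp (hA _).neg).mul (hξ _)).ennreal_ofReal
  have hZm : Measurable Z := Finset.measurable_fun_sum _ fun i _ => (hfm i).indicator (hB i)
  have hZint : ∫⁻ ω, Z ω ∂P ≤ κ := by
    rw [lintegral_finsetSum _ fun i _ => (hfm i).indicator (hB i)]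
    simp_rw [lintegral_indicator (hB _)]
    exact hκ
  have hUm : MeasurableSet (⋃ i ∈ Finset.range m, B i) :=
    Finset.measurableSet_biUnion _ fun i _ => hB i
  set F : Ω → ℝ≥0∞ := fun ω => ENNReal.ofReal (Real.exp (p * A t ω)) with hF
  have hFm : Measurable F := (Real.measurable_exp.comp ((hA t).const_mul p)).ennreal_ofReal
  have hpt : ∀ᵐ ω ∂P, ω ∈ (⋃ i ∈ Finset.range m, B i) →
      ENNReal.ofReal (c ^ p) ≤ F ω * Z ω ^ p := by
    filter_upwards [hmono] with ω hm hω
    simp only [mem_iUnion] at hω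
    obtain ⟨i, hi, hωi⟩ := hω
    have h1 : ENNReal.ofReal (Real.exp (-A t ω) * c) ≤ Z ω := by
      calc _ ≤ ENNReal.ofReal (Real.exp (-A (r i) ω) * ξ (r i) ω) := by
            refine ENNReal.ofReal_le_ofReal (mul_le_mul ?_ (hBc i ω hωi) hc (Real.exp_pos _).le)
            exact Real.exp_le_exp.2 (neg_le_neg (hm (hrt i (Finset.mem_range.1 hi))))
        _ = (B i).indicator (fun ω => ENNReal.ofReal (Real.exp (-A (r i) ω) * ξ (r i) ω)) ω :=
            by rw [indicator_of_mem hωi]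
        _ ≤ Z ω := Finset.single_le_sum (f := fun i => (B i).indicator
              (fun ω => ENNReal.ofReal (Real.exp (-A (r i) ω) * ξ (r i) ω)) ω)
              (fun _ _ => zero_le) hi
    calc ENNReal.ofReal (c ^ p)
        = F ω * ENNReal.ofReal (Real.exp (-A t ω) * c) ^ p := by
          rw [hF, ENNReal.ofReal_rpow_of_nonneg (mul_nonneg (Real.exp_pos _).le hc) hp0.le,
            ← ENNReal.ofReal_mul (Real.exp_pos _).le, Real.mul_rpow (Real.exp_pos _).le hc,
            ← Real.exp_mul, ← mul_assoc, ← Real.exp_add]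
          congr 1
          rw [show p * A t ω + -A t ω * p = 0 by ring, Real.exp_zero, one_mul]
      _ ≤ F ω * Z ω ^ p := by gcongr
  have hconj : (1 - p)⁻¹.HolderConjugate p⁻¹ := by
    rw [Real.holderConjugate_iff]
    constructor
    · rw [one_lt_inv₀ (by linarith)]; linarith
    · rw [inv_inv, inv_inv]; ring
  have hHolder := ENNReal.lintegral_mul_le_Lp_mul_Lq P hconj hFm.aemeasurable
    (hZm.pow_const p).aemeasurable
  have e1 : ∀ ω, F ω ^ (1 - p)⁻¹ = ENNReal.ofReal (Real.exp (p * A t ω / (1 - p))) := fun ω => by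
    rw [hF, ENNReal.ofReal_rpow_of_nonneg (Real.exp_pos _).le (by
      rw [inv_nonneg]; linarith), ← Real.exp_mul, div_eq_mul_inv]
  have e2 : ∀ ω, (Z ω ^ p) ^ p⁻¹ = Z ω := fun ω => ENNReal.rpow_rpow_inv hp0.ne' _
  simp only [e1, e2, one_div, inv_inv] at hHolder
  calc ENNReal.ofReal (c ^ p) * P (⋃ i ∈ Finset.range m, B i)
      = ∫⁻ _ in ⋃ i ∈ Finset.range m, B i, ENNReal.ofReal (c ^ p) ∂P := by
        rw [setLIntegral_const]
    _ ≤ ∫⁻ ω in ⋃ i ∈ Finset.range m, B i, F ω * Z ω ^ p ∂P :=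
        lintegral_mono_ae ((ae_restrict_iff' hUm).2 hpt)
    _ ≤ ∫⁻ ω, F ω * Z ω ^ p ∂P := setLIntegral_le_lintegral _ _
    _ ≤ _ := hHolder
    _ ≤ _ := by gcongr

/-- Maximal inequality for the discounted process along finitely many times `r 0 ≤ r 1 ≤ ⋯`, where
only the times in the random sets given by `S` count. -/
lemma rpow_mul_measure_le [IsProbabilityMeasure P] (h : IsDiscountPair Y A 𝓕 P)
    (hY0 : ∀ᵐ ω ∂P, Y 0 ω = 0)
    (hH : Integrable H P) (hξ : StronglyAdapted 𝓕 ξ) (hξ0 : ∀ᵐ ω ∂P, ∀ s, 0 ≤ ξ s ω)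
    (hr : Monotone r) {m : ℕ} (hrt : ∀ i < m, r i ≤ t)
    {S : ℝ≥0 → Set Ω} (hS : ∀ s, MeasurableSet[𝓕 s] (S s))
    (hle : ∀ s ≤ t, ∀ᵐ ω ∂P, ω ∈ S s → Real.exp (-A s ω) * ξ s ω ≤ H ω + discounted Y A s ω)
    (hge : ∀ᵐ ω ∂P, 0 ≤ H ω + discounted Y A t ω)
    {c p : ℝ} (hc : 0 ≤ c) (hp0 : 0 < p) (hp1 : p < 1) :
    ENNReal.ofReal (c ^ p) * P {ω | ∃ i < m, ω ∈ S (r i) ∧ c < ξ (r i) ω} ≤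
      (∫⁻ ω, ENNReal.ofReal (Real.exp (p * A t ω / (1 - p))) ∂P) ^ (1 - p) *
        ENNReal.ofReal (∫ ω, H ω ∂P) ^ p := by
  set C : ℕ → Set Ω := fun i => S (r i) ∩ {ω | c < ξ (r i) ω} with hC
  have hCm : ∀ i, MeasurableSet[𝓕 (r i)] (C i) := fun i =>
    (hS _).inter (measurableSet_lt measurable_const (hξ (r i)).measurable)
  -- `disjointed C i` is the event that `i` is the first index with `C i`; it is decided by time `r
  -- i` because `r` is monotone.
  have hBm : ∀ i, MeasurableSet[𝓕 (r i)] (disjointed C i) := fun i => by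
    rw [disjointed_eq_inter_compl]
    exact (hCm i).inter (MeasurableSet.biInter (to_countable _) fun j hj =>
      (𝓕.mono (hr (le_of_lt hj)) _ (hCm j)).compl)
  have hsub : ∀ i, disjointed C i ⊆ C i := disjointed_subset C
  have hset : {ω | ∃ i < m, ω ∈ S (r i) ∧ c < ξ (r i) ω} ⊆
      ⋃ i ∈ Finset.range m, disjointed C i := by
    rintro ω ⟨i, hi, hω⟩
    classical
    have hex : ∃ j, ω ∈ C j := ⟨i, hω⟩
    refine mem_iUnion₂.2 ⟨Nat.find hex,
      Finset.mem_range.2 ((Nat.find_min' hex hω).trans_lt hi), ?_⟩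
    rw [disjointed_eq_inter_compl]
    exact ⟨Nat.find_spec hex, mem_iInter₂.2 fun j hj => Nat.find_min hex hj⟩
  refine le_trans (by gcongr) (rpow_mul_measure_le_of_sum_le
    (fun s => ((h.adapted s).mono (𝓕.le s)).measurable)
    (fun s => ((hξ s).mono (𝓕.le s)).measurable) h.mono hrt (fun i => 𝓕.le _ _ (hBm i)) hc hp0 hp1
    (fun i ω hω => (hsub i hω).2.le)
    (sum_lintegral_discounted_le h hY0 hH hξ0 hrt hBm (disjoint_disjointed C) (fun i hi => ?_) hge))
  filter_upwards [hle (r i) (hrt i hi)] with ω hω hmem using hω (hsub i hmem).1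

end Maximal

/-! ### From weak type to strong type -/

section LayerCake

variable {Ω : Type*} {mΩ : MeasurableSpace Ω} {P : Measure Ω} [IsProbabilityMeasure P]

lemma lintegral_Ioc_rpow {c q : ℝ} (hc : 0 ≤ c) (hq : 0 < q) :
    ∫⁻ x in Ioc 0 c, ENNReal.ofReal (x ^ (q - 1)) = ENNReal.ofReal (c ^ q / q) := by
  have hint : IntervalIntegrable (fun x : ℝ => x ^ (q - 1)) volume 0 c :=
    intervalIntegral.intervalIntegrable_rpow' (by linarith)
  rw [← ofReal_integral_eq_lintegral_ofReal
      ((intervalIntegrable_iff_integrableOn_Ioc_of_le hc).1 hint)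
      ((ae_restrict_iff' measurableSet_Ioc).2 (ae_of_all _ fun x hx => Real.rpow_nonneg hx.1.le _)),
    ← intervalIntegral.integral_of_le hc, integral_rpow (Or.inl (by linarith)), sub_add_cancel,
    Real.zero_rpow hq.ne', sub_zero]

lemma lintegral_Ioi_rpow {c q : ℝ} (hc : 0 < c) (hq : 0 < q) :
    ∫⁻ x in Ioi c, ENNReal.ofReal (x ^ (-q - 1)) = ENNReal.ofReal (c ^ (-q) / q) := by
  rw [← ofReal_integral_eq_lintegral_ofReal (integrableOn_Ioi_rpow_of_lt (by linarith) hc)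
      ((ae_restrict_iff' measurableSet_Ioi).2
        (ae_of_all _ fun x hx => Real.rpow_nonneg (hc.trans hx).le _)),
    integral_Ioi_rpow_of_lt (by linarith) hc, sub_add_cancel, neg_div_neg_eq]

/-- A weak-type bound of order `p` gives a moment bound of every order `q < p`. -/
lemma lintegral_rpow_le_of_tail_le {X : Ω → ℝ} (hX : Measurable X) (hX0 : 0 ≤ X) {c p q : ℝ}
    (hc : 0 ≤ c) (hq : 0 < q) (hqp : q < p)
    (htail : ∀ x, 0 < x → P {ω | x < X ω} ≤ ENNReal.ofReal ((c / x) ^ p)) :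
    ∫⁻ ω, ENNReal.ofReal (X ω ^ q) ∂P ≤ ENNReal.ofReal (p / (p - q) * c ^ q) := by
  have hp : 0 < p := hq.trans hqp
  rw [lintegral_rpow_eq_lintegral_meas_lt_mul P (ae_of_all _ hX0) hX.aemeasurable hq]
  -- For `c = 0` the power integral over `(c, ∞)` used below diverges, but the tail itself vanishes.
  rcases hc.eq_or_lt with rfl | hc
  · have : ∫⁻ x in Ioi (0 : ℝ), P {ω | x < X ω} * ENNReal.ofReal (x ^ (q - 1)) = 0 := by
      rw [setLIntegral_congr_fun measurableSet_Ioi (g := fun _ => 0), lintegral_zero]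
      intro x hx
      have := htail x hx
      rw [zero_div, Real.zero_rpow hp.ne', ENNReal.ofReal_zero, nonpos_iff_eq_zero] at this
      simp [this]
    rw [this, mul_zero]
    exact zero_le
  -- At `x = c` the tail bound crosses the trivial bound `1`. The two parts yield `q * (1 / q + 1 /
  -- (p - q)) = p / (p - q)`.
  have hsplit : Ioi (0 : ℝ) = Ioc 0 c ∪ Ioi c := (Ioc_union_Ioi_eq_Ioi hc.le).symm
  have h1 : ∫⁻ x in Ioc 0 c, P {ω | x < X ω} * ENNReal.ofReal (x ^ (q - 1)) ≤
      ENNReal.ofReal (c ^ q / q) := by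
    rw [← lintegral_Ioc_rpow hc.le hq]
    exact lintegral_mono fun x => mul_le_of_le_one_left zero_le prob_le_one
  have h2 : ∫⁻ x in Ioi c, P {ω | x < X ω} * ENNReal.ofReal (x ^ (q - 1)) ≤
      ENNReal.ofReal (c ^ q / (p - q)) := by
    calc _ ≤ ∫⁻ x in Ioi c, ENNReal.ofReal (c ^ p) * ENNReal.ofReal (x ^ (-(p - q) - 1)) := by
          refine setLIntegral_mono' measurableSet_Ioi fun x hx => ?_
          have hx0 : 0 < x := hc.trans hx
          calc _ ≤ ENNReal.ofReal ((c / x) ^ p) * ENNReal.ofReal (x ^ (q - 1)) := by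
                gcongr; exact htail x hx0
            _ = _ := by
                rw [← ENNReal.ofReal_mul (by positivity), ← ENNReal.ofReal_mul (by positivity),
                  Real.div_rpow hc.le hx0.le, div_mul_eq_mul_div, mul_div_assoc,
                  ← Real.rpow_sub hx0]
                ring_nf
      _ = ENNReal.ofReal (c ^ p) * ENNReal.ofReal (c ^ (-(p - q)) / (p - q)) := by
          rw [lintegral_const_mul' _ _ ENNReal.ofReal_ne_top, lintegral_Ioi_rpow hc (by linarith)]
      _ = _ := by
          rw [← ENNReal.ofReal_mul (by positivity), ← mul_div_assoc, ← Real.rpow_add hc]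
          ring_nf
  have hpq : 0 < p - q := sub_pos.2 hqp
  rw [hsplit, lintegral_union measurableSet_Ioi (Ioc_disjoint_Ioi le_rfl)]
  calc _ ≤ ENNReal.ofReal q * (ENNReal.ofReal (c ^ q / q) + ENNReal.ofReal (c ^ q / (p - q))) := by
        gcongr
    _ = _ := by
        rw [← ENNReal.ofReal_add (by positivity) (by positivity), ← ENNReal.ofReal_mul hq.le]
        congr 1
        field_simp
        ring

end LayerCake

/-! ### Paths: from countably many times to all times, and stopping -/

section Paths

variable {a ξ f : ℝ≥0 → ℝ} {t : ℝ≥0} {h : ℝ}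

lemma toReal_lintegral_Icc_le (hc : Continuous a) (hm : Monotone a) {C : ℝ} (hC0 : 0 ≤ C)
    (hC : ∀ u ∈ Icc 0 t, |ξ u| ≤ C) {u v : ℝ≥0} (huv : u ≤ v) (hv : v ≤ t) :
    (∫⁻ r in Icc 0 v, ENNReal.ofReal (ξ r) ∂pathMeasure a).toReal ≤
      (∫⁻ r in Icc 0 u, ENNReal.ofReal (ξ r) ∂pathMeasure a).toReal + C * (a v - a u) := by
  have hd : 0 ≤ a v - a u := sub_nonneg.2 (hm huv)
  have hfin := (lintegral_Icc_lt_top (ξ := ξ) hc hm hC (huv.trans hv)).ne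
  have h1 : ∫⁻ r in Icc 0 v, ENNReal.ofReal (ξ r) ∂pathMeasure a ≤
      (∫⁻ r in Icc 0 u, ENNReal.ofReal (ξ r) ∂pathMeasure a) + ENNReal.ofReal (C * (a v - a u)) := by
    calc _ ≤ (∫⁻ r in Icc 0 u, ENNReal.ofReal (ξ r) ∂pathMeasure a) +
          ∫⁻ r in Ioc u v, ENNReal.ofReal (ξ r) ∂pathMeasure a := by
          rw [← Icc_union_Ioc_eq_Icc zero_le huv]
          exact lintegral_union_le _ _ _
      _ ≤ (∫⁻ r in Icc 0 u, ENNReal.ofReal (ξ r) ∂pathMeasure a) +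
          ∫⁻ r in Ioc u v, ENNReal.ofReal C ∂pathMeasure a := by
          refine add_le_add_right (setLIntegral_mono' measurableSet_Ioc fun r hr =>
            ENNReal.ofReal_le_ofReal ?_) _
          exact (le_abs_self _).trans (hC r ⟨zero_le, hr.2.trans hv⟩)
      _ = _ := by
          rw [setLIntegral_const, pathMeasure_Ioc hc hm, ENNReal.ofReal_mul hC0]
  calc _ ≤ ((∫⁻ r in Icc 0 u, ENNReal.ofReal (ξ r) ∂pathMeasure a) +
        ENNReal.ofReal (C * (a v - a u))).toReal :=
        ENNReal.toReal_mono (ENNReal.add_ne_top.2 ⟨hfin, ENNReal.ofReal_ne_top⟩) h1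
    _ = _ := by
        rw [ENNReal.toReal_add hfin ENNReal.ofReal_ne_top,
          ENNReal.toReal_ofReal (mul_nonneg hC0 hd)]

/-- Right-continuity propagates the inequality from `D` to every `u < t`. The endpoint is assumed
separately, since approaching it from the right leaves `[0, t]`. -/
lemma le_of_le_on_dense (hc : Continuous a) (hm : Monotone a) (hξ : IsCadlag ξ) (hf : IsCadlag f)
    {D : Set ℝ≥0} (hD : Dense D)
    (hleD : ∀ u ∈ D, u ≤ t →
      ξ u ≤ h + (∫⁻ r in Icc 0 u, ENNReal.ofReal (ξ r) ∂pathMeasure a).toReal + f u)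
    (hlet : ξ t ≤ h + (∫⁻ r in Icc 0 t, ENNReal.ofReal (ξ r) ∂pathMeasure a).toReal + f t)
    {u : ℝ≥0} (hu : u ≤ t) :
    ξ u ≤ h + (∫⁻ r in Icc 0 u, ENNReal.ofReal (ξ r) ∂pathMeasure a).toReal + f u := by
  rcases hu.eq_or_lt with rfl | hut
  · exact hlet
  obtain ⟨C, hC⟩ := hξ.exists_bound t
  have hC0 : 0 ≤ C := (abs_nonneg _).trans (hC 0 ⟨le_rfl, zero_le⟩)
  by_contra! hlt
  set G := (∫⁻ r in Icc 0 u, ENNReal.ofReal (ξ r) ∂pathMeasure a).toReal with hG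
  -- The integral up to `v` is replaced by its upper bound `G + C * (a v - a u)`, which is visibly
  -- continuous in `v`.
  have hcont : ContinuousWithinAt (fun v => ξ v - (h + (G + C * (a v - a u)) + f v)) (Ici u) u := by
    refine (hξ.1 u).sub (ContinuousWithinAt.add (Continuous.continuousWithinAt ?_) (hf.1 u))
    fun_prop
  have hpos : 0 < ξ u - (h + (G + C * (a u - a u)) + f u) := by
    rw [sub_self, mul_zero, add_zero]; linarith
  have hev := (hcont.tendsto.eventually (lt_mem_nhds hpos)).filter_mono
    (nhdsWithin_mono u Ioi_subset_Ici_self)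
  obtain ⟨w, hw, hsub⟩ := (mem_nhdsGT_iff_exists_Ioo_subset' hut).1 hev
  obtain ⟨v, hvD, hv1, hv2⟩ := hD.exists_between (lt_min hw hut)
  have h1 := hleD v hvD (hv2.le.trans (min_le_right _ _))
  have h2 : 0 < ξ v - (h + (G + C * (a v - a u)) + f v) :=
    hsub ⟨hv1, hv2.trans_le (min_le_left _ _)⟩
  have h3 := toReal_lintegral_Icc_le hc hm hC0 hC hv1.le (hv2.le.trans (min_le_right _ _))
  linarith

/-- The path `f` stopped at the (possibly infinite) time `σ`. -/
noncomputable def stopPath (f : ℝ≥0 → ℝ) (σ : WithTop ℝ≥0) (v : ℝ≥0) : ℝ :=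
  f (min (v : WithTop ℝ≥0) σ).untopA

lemma stopPath_of_le {σ : WithTop ℝ≥0} {v : ℝ≥0} (hv : (v : WithTop ℝ≥0) ≤ σ) :
    stopPath f σ v = f v := by
  rw [stopPath, min_eq_left hv]; rfl

lemma stopPath_coe (c v : ℝ≥0) : stopPath f c v = f (min v c) := by
  rw [stopPath, ← WithTop.coe_min]; rfl

lemma stopPath_top : stopPath f ⊤ = f := funext fun _ => stopPath_of_le le_top

lemma continuousWithinAt_stopPath (hf : IsCadlag f) (σ : WithTop ℝ≥0) (u : ℝ≥0) :
    ContinuousWithinAt (stopPath f σ) (Ici u) u := by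
  cases σ with
  | top => rw [stopPath_top]; exact hf.1 u
  | coe c =>
    have : stopPath f c = f ∘ fun v => min v c := funext fun v => stopPath_coe c v
    rw [this]
    refine ContinuousWithinAt.comp (t := Ici (min u c)) (hf.1 (min u c)) ?_
      fun v hv => min_le_min_right c hv
    exact Continuous.continuousWithinAt (by fun_prop)

lemma exists_bound_stopPath (hf : IsCadlag f) (σ : WithTop ℝ≥0) (t : ℝ≥0) :
    ∃ C, ∀ u ∈ Icc 0 t, |stopPath f σ u| ≤ C := by
  obtain ⟨C, hC⟩ := hf.exists_bound t
  refine ⟨C, fun u hu => ?_⟩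
  cases σ with
  | top => rw [stopPath_top]; exact hC u hu
  | coe c => rw [stopPath_coe]; exact hC _ ⟨zero_le, (min_le_left _ _).trans hu.2⟩

lemma exp_neg_mul_le_stopPath (hc : Continuous a) (hm : Monotone a) (h0 : a 0 = 0)
    (hξm : Measurable ξ) (hξ0 : ∀ u, 0 ≤ ξ u) (hξ : IsCadlag ξ) (hf : IsCadlag f)
    (hle : ∀ u ≤ t,
      ξ u ≤ h + (∫⁻ r in Icc 0 u, ENNReal.ofReal (ξ r) ∂pathMeasure a).toReal + f u)
    {σ : WithTop ℝ≥0} {s : ℝ≥0} (hs : s ≤ t) (hsσ : (s : WithTop ℝ≥0) ≤ σ) :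
    Real.exp (-a s) * ξ s ≤ h + (stopPath f σ s * Real.exp (-a s) +
      ∫ u in Ioc 0 s, stopPath f σ u * Real.exp (-a u) ∂pathMeasure a) := by
  obtain ⟨C, hC⟩ := hξ.exists_bound s
  obtain ⟨D, hD⟩ := exists_bound_stopPath hf σ s
  refine exp_neg_mul_le hc hm h0 hξm hξ0 hC (continuousWithinAt_stopPath hf σ) hD fun u hu => ?_
  rw [stopPath_of_le ((WithTop.coe_le_coe.2 hu).trans hsσ)]
  exact hle u (hu.trans hs)

/-- The Gronwall bound is available only up to `σ`. Past `σ` the stopped path is constant, so the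
discounted expression freezes at its value at `σ`, where it dominates `e^{-a} ξ ≥ 0`. -/
lemma nonneg_add_stopPath (hc : Continuous a) (hm : Monotone a) (h0 : a 0 = 0)
    (hξm : Measurable ξ) (hξ0 : ∀ u, 0 ≤ ξ u) (hξ : IsCadlag ξ) (hf : IsCadlag f)
    (hle : ∀ u ≤ t,
      ξ u ≤ h + (∫⁻ r in Icc 0 u, ENNReal.ofReal (ξ r) ∂pathMeasure a).toReal + f u)
    (σ : WithTop ℝ≥0) :
    0 ≤ h + (stopPath f σ t * Real.exp (-a t) +
      ∫ u in Ioc 0 t, stopPath f σ u * Real.exp (-a u) ∂pathMeasure a) := by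
  have hnn : ∀ s, 0 ≤ Real.exp (-a s) * ξ s := fun s => mul_nonneg (Real.exp_pos _).le (hξ0 s)
  rcases le_total (t : WithTop ℝ≥0) σ with htσ | hσt
  · exact (hnn t).trans (exp_neg_mul_le_stopPath hc hm h0 hξm hξ0 hξ hf hle le_rfl htσ)
  · cases σ with
    | top => exact (hnn t).trans (exp_neg_mul_le_stopPath hc hm h0 hξm hξ0 hξ hf hle le_rfl le_top)
    | coe c =>
      have hct : c ≤ t := WithTop.coe_le_coe.1 hσt
      refine (hnn c).trans ((exp_neg_mul_le_stopPath hc hm h0 hξm hξ0 hξ hf hle hct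
        (le_refl (c : WithTop ℝ≥0))).trans (le_of_eq ?_))
      obtain ⟨D, hD⟩ := exists_bound_stopPath hf c t
      have hI := integrableOn_mul_exp_neg hc hm h0 (continuousWithinAt_stopPath hf c) hD
      have hsplit : Ioc 0 t = Ioc 0 c ∪ Ioc c t := (Ioc_union_Ioc_eq_Ioc zero_le hct).symm
      have htail : ∫ u in Ioc c t, stopPath f c u * Real.exp (-a u) ∂pathMeasure a =
          f c * (Real.exp (-a c) - Real.exp (-a t)) := by
        rw [← integral_exp_neg hc hm h0 hct, ← integral_const_mul]
        refine setIntegral_congr_fun measurableSet_Ioc fun u hu => ?_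
        simp only [stopPath_coe, min_eq_right hu.1.le]
      rw [hsplit, setIntegral_union (Ioc_disjoint_Ioc_of_le le_rfl) measurableSet_Ioc
        (hI.mono_set (Ioc_subset_Ioc_right hct)) (hI.mono_set (Ioc_subset_Ioc_left zero_le)), htail,
        stopPath_coe, stopPath_coe, min_self, min_eq_right hct]
      ring

lemma eventually_exists_gridPoint_gt {x : ℝ≥0 → ℝ} (hx : ∀ u, ContinuousWithinAt x (Ici u) u)
    {u : ℝ≥0} (hu : u ≤ t) {c : ℝ} (hc : c < x u) :
    ∀ᶠ n in atTop, ∃ i < n + 2, c < x (gridPoint 0 t n i) := by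
  rcases eq_zero_or_pos u with rfl | hu0
  · exact Eventually.of_forall fun n => ⟨0, by lia, by rwa [gridPoint_zero]⟩
  · have hmem : u ∈ Ioc 0 t := ⟨hu0, hu⟩
    filter_upwards [(tendsto_rightStep hx hmem).eventually (lt_mem_nhds hc)] with n hn
    obtain ⟨r, -, -, -, ⟨i, hi, rfl⟩, hr⟩ := exists_rightStep_eq x hmem n
    exact ⟨i, hi, hr ▸ hn⟩

/-- Passes to real numbers and enlarges the `η` integral to the full interval, so that one variable
`H` serves all times. -/
lemma toReal_le_of_ereal_le {x y m : ℝ} {I J G : ℝ≥0∞} (hy : 0 ≤ y) (hIJ : I ≤ J) (hJ : J ≠ ∞)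
    (hG : G ≠ ∞) (hle : (x : EReal) ≤ (y : EReal) + (I : EReal) + (G : EReal) + (m : EReal)) :
    x ≤ (ENNReal.ofReal y + J).toReal + G.toReal + m := by
  have hI : I ≠ ∞ := ne_top_of_le_ne_top hJ hIJ
  rw [← EReal.coe_ennreal_toReal hI, ← EReal.coe_ennreal_toReal hG] at hle
  rw [ENNReal.toReal_add ENNReal.ofReal_ne_top hJ, ENNReal.toReal_ofReal hy]
  have h1 : x ≤ y + I.toReal + G.toReal + m := by exact_mod_cast hle
  have h2 := ENNReal.toReal_mono hJ hIJ
  linarith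

end Paths

/-! ### The stochastic Gronwall inequality -/

section Main

variable {Ω : Type*} {mΩ : MeasurableSpace Ω} {P : Measure Ω}
  {𝓕 : Filtration ℝ≥0 mΩ} {ξ A M : ℝ≥0 → Ω → ℝ} {t : ℝ≥0}

/-- The maximum of `ξ` over the points of the `n`-th partition of `[0, t]` which do not exceed
`σ`. -/
noncomputable def gridMax (ξ : ℝ≥0 → Ω → ℝ) (t : ℝ≥0) (σ : Ω → WithTop ℝ≥0) (n : ℕ) (ω : Ω) : ℝ≥0 :=
  (Finset.range (n + 2)).sup fun i =>
    {ω | (gridPoint 0 t n i : WithTop ℝ≥0) ≤ σ ω}.indicator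
      (fun ω => (ξ (gridPoint 0 t n i) ω).toNNReal) ω

lemma measurable_gridMax (hξ : StronglyAdapted 𝓕 ξ) {σ : Ω → WithTop ℝ≥0}
    (hσ : IsStoppingTime 𝓕 σ) (n : ℕ) : Measurable (gridMax ξ t σ n) := by
  unfold gridMax
  induction (Finset.range (n + 2)) using Finset.cons_induction with
  | empty => simp only [Finset.sup_empty]; exact measurable_const
  | cons i s hi ih =>
    simp only [Finset.sup_cons]
    refine Measurable.sup (Measurable.indicator ?_ ?_) ih
    · exact (((hξ _).mono (𝓕.le _)).measurable).real_toNNReal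
    · exact 𝓕.le _ _ (hσ.measurableSet_ge _)

lemma exists_of_lt_gridMax {σ : Ω → WithTop ℝ≥0} {n : ℕ} {ω : Ω} {x : ℝ} (hx : 0 < x)
    (h : x < gridMax ξ t σ n ω) :
    ∃ i < n + 2, (gridPoint 0 t n i : WithTop ℝ≥0) ≤ σ ω ∧ x < ξ (gridPoint 0 t n i) ω := by
  lift x to ℝ≥0 using hx.le
  obtain ⟨i, hi, hlt⟩ := Finset.lt_sup_iff.1 (NNReal.coe_lt_coe.1 h)
  have hmem : ω ∈ {ω | (gridPoint 0 t n i : WithTop ℝ≥0) ≤ σ ω} := by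
    by_contra hn
    rw [indicator_of_notMem hn] at hlt
    exact not_lt_zero hlt
  rw [indicator_of_mem hmem, Real.lt_toNNReal_iff_coe_lt] at hlt
  exact ⟨i, Finset.mem_range.1 hi, hmem, hlt⟩

lemma le_gridMax {σ : Ω → WithTop ℝ≥0} {n i : ℕ} {ω : Ω} (hi : i < n + 2)
    (hσ : (gridPoint 0 t n i : WithTop ℝ≥0) ≤ σ ω) :
    ξ (gridPoint 0 t n i) ω ≤ gridMax ξ t σ n ω := by
  have h1 := Finset.le_sup (f := fun i => {ω | (gridPoint 0 t n i : WithTop ℝ≥0) ≤ σ ω}.indicator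
    (fun ω => (ξ (gridPoint 0 t n i) ω).toNNReal) ω) (Finset.mem_range.2 hi)
  have hmem : ω ∈ {ω | (gridPoint 0 t n i : WithTop ℝ≥0) ≤ σ ω} := hσ
  rw [indicator_of_mem hmem] at h1
  exact (Real.le_coe_toNNReal _).trans (NNReal.coe_le_coe.2 h1)

lemma gridPoint_le {n i : ℕ} (hi : i < n + 2) : gridPoint 0 t n i ≤ t := by
  have h := gridPoint_mono 0 t n (show i ≤ n + 1 by lia)
  rwa [gridPoint_last zero_le] at h

/-- Any level exceeded on `[0, t]` is eventually exceeded at a grid point, and eventually `τ n` is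
beyond `t`. Grid and localization share one index, so a single use of Fatou's lemma suffices. -/
lemma iSup_rpow_le_liminf {τ : ℕ → Ω → WithTop ℝ≥0} {ω : Ω} (hξ : IsCadlag (fun s => ξ s ω))
    (hτ : Tendsto (τ · ω) atTop (𝓝 ⊤)) {q : ℝ} (hq : 0 < q) :
    (⨆ s ∈ Icc (0 : ℝ≥0) t, ENNReal.ofReal (ξ s ω)) ^ q ≤
      liminf (fun n => ENNReal.ofReal ((gridMax ξ t (τ n) n ω : ℝ) ^ q)) atTop := by
  refine le_of_forall_lt fun y hy => ?_
  obtain ⟨y', hyy', hy'⟩ := exists_between hy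
  refine hyy'.trans_le (le_liminf_of_le (by isBoundedDefault) ?_)
  have hz : y' ^ q⁻¹ < ⨆ s ∈ Icc (0 : ℝ≥0) t, ENNReal.ofReal (ξ s ω) := by
    rwa [ENNReal.rpow_inv_lt_iff hq]
  simp only [lt_iSup_iff] at hz
  obtain ⟨s, hs, hlt⟩ := hz
  have hfin : y' ^ q⁻¹ ≠ ∞ := (hlt.trans ENNReal.ofReal_lt_top).ne
  have hlt' : (y' ^ q⁻¹).toReal < ξ s ω := (ENNReal.lt_ofReal_iff_toReal_lt hfin).1 hlt
  filter_upwards [eventually_exists_gridPoint_gt hξ.1 hs.2 hlt',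
    hτ.eventually (lt_mem_nhds (WithTop.coe_lt_top t))] with n ⟨i, hi, hgt⟩ hτn
  have hle := le_gridMax (ξ := ξ) (σ := τ n) hi
    ((WithTop.coe_le_coe.2 (gridPoint_le (t := t) hi)).trans hτn.le)
  rw [← ENNReal.ofReal_rpow_of_nonneg (NNReal.coe_nonneg _) hq.le, ← ENNReal.rpow_inv_le_iff hq]
  exact ((ENNReal.lt_ofReal_iff_toReal_lt hfin).2 (hgt.trans_le hle)).le

/-- Where the indicator kills the process, `σ = 0` and the stopped path is constantly `M 0 = 0`. -/
lemma ae_stoppedProcess_eq_stopPath (hM0 : ∀ᵐ ω ∂P, M 0 ω = 0) (σ : Ω → WithTop ℝ≥0) :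
    ∀ᵐ ω ∂P, ∀ v, stoppedProcess (fun i ↦ {ω | ⊥ < σ ω}.indicator (M i)) σ v ω =
      stopPath (fun u => M u ω) (σ ω) v := by
  filter_upwards [hM0] with ω h0 v
  by_cases hσ : ⊥ < σ ω
  · have hmem : ω ∈ {ω | ⊥ < σ ω} := hσ
    simp only [stoppedProcess, stopPath, indicator_of_mem hmem]
  · have hmem : ω ∉ {ω | ⊥ < σ ω} := hσ
    have hbot : σ ω = ((0 : ℝ≥0) : WithTop ℝ≥0) := not_bot_lt_iff.1 hσ
    simp only [stoppedProcess, indicator_of_notMem hmem]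
    rw [hbot, stopPath_coe, min_eq_right zero_le, h0]

lemma lintegral_gridMax_le [IsProbabilityMeasure P]
    (hξ_meas : Measurable (fun z : ℝ≥0 × Ω => ξ z.1 z.2)) (hξ_adapted : StronglyAdapted 𝓕 ξ)
    (hξ_nonneg : ∀ᵐ ω ∂P, ∀ t, 0 ≤ ξ t ω) (hξ_cadlag : ∀ᵐ ω ∂P, IsCadlag (fun t => ξ t ω))
    (hA_adapted : StronglyAdapted 𝓕 A) (hA_cont : ∀ᵐ ω ∂P, Continuous (fun t => A t ω))
    (hA_mono : ∀ᵐ ω ∂P, Monotone (fun t => A t ω)) (hA_zero : ∀ᵐ ω ∂P, A 0 ω = 0)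
    (hM_cadlag : ∀ᵐ ω ∂P, IsCadlag (fun t => M t ω)) (hM_zero : ∀ᵐ ω ∂P, M 0 ω = 0)
    {σ : Ω → WithTop ℝ≥0} (hσ : IsStoppingTime 𝓕 σ)
    (hmart : Martingale (stoppedProcess (fun i ↦ {ω | ⊥ < σ ω}.indicator (M i)) σ) 𝓕 P)
    {H : Ω → ℝ} (hH : Integrable H P)
    (hle : ∀ᵐ ω ∂P, ∀ u ≤ t, ξ u ω ≤ H ω + (∫⁻ r in Icc 0 u, ENNReal.ofReal (ξ r ω)
      ∂pathMeasure (fun v => A v ω)).toReal + M u ω)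
    {p q : ℝ} (hq : 0 < q) (hqp : q < p) (hp : p < 1) {D : ℝ≥0∞} (hD : D ≠ ∞)
    (hDeq : (∫⁻ ω, ENNReal.ofReal (Real.exp (p * A t ω / (1 - p))) ∂P) ^ (1 - p) *
        ENNReal.ofReal (∫ ω, H ω ∂P) ^ p = D) (n : ℕ) :
    ∫⁻ ω, ENNReal.ofReal ((gridMax ξ t σ n ω : ℝ) ^ q) ∂P ≤
      ENNReal.ofReal (p / (p - q) * (D.toReal ^ p⁻¹) ^ q) := by
  have hp0 : 0 < p := hq.trans hqp
  set Y := stoppedProcess (fun i ↦ {ω | ⊥ < σ ω}.indicator (M i)) σ with hYdef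
  have hYeq : ∀ᵐ ω ∂P, ∀ v, Y v ω = stopPath (fun u => M u ω) (σ ω) v :=
    ae_stoppedProcess_eq_stopPath hM_zero σ
  have hpair : IsDiscountPair Y A 𝓕 P := by
    refine ⟨hmart, ?_, ?_, hA_adapted, hA_cont, hA_mono, hA_zero⟩
    · filter_upwards [hYeq, hM_cadlag] with ω h1 h2 u
      have : (fun v => Y v ω) = stopPath (fun u => M u ω) (σ ω) := funext h1
      rw [this]
      exact continuousWithinAt_stopPath h2 _ u
    · filter_upwards [hYeq, hM_cadlag] with ω h1 h2 s
      obtain ⟨C, hC⟩ := exists_bound_stopPath h2 (σ ω) s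
      exact ⟨C, fun u hu => by rw [h1]; exact hC u hu⟩
  have hY0 : ∀ᵐ ω ∂P, Y 0 ω = 0 := by
    filter_upwards [hYeq, hM_zero] with ω h1 h2
    have h0 : ((0 : ℝ≥0) : WithTop ℝ≥0) ≤ σ ω := bot_le
    rw [h1, stopPath_of_le h0, h2]
  have hpath : ∀ ω, Measurable (fun u => ξ u ω) := fun ω =>
    hξ_meas.comp (measurable_id.prodMk measurable_const)
  have hle1 : ∀ s ≤ t, ∀ᵐ ω ∂P, ω ∈ {ω | (s : WithTop ℝ≥0) ≤ σ ω} →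
      Real.exp (-A s ω) * ξ s ω ≤ H ω + discounted Y A s ω := by
    intro s hs
    filter_upwards [hYeq, hM_cadlag, hξ_cadlag, hξ_nonneg, hA_cont, hA_mono, hA_zero, hle]
      with ω h1 h2 h3 h4 h5 h6 h7 h8 hmem
    have := exp_neg_mul_le_stopPath h5 h6 h7 (hpath ω) h4 h3 h2 h8 hs hmem
    simp only [discounted, h1]
    exact this
  have hge : ∀ᵐ ω ∂P, 0 ≤ H ω + discounted Y A t ω := by
    filter_upwards [hYeq, hM_cadlag, hξ_cadlag, hξ_nonneg, hA_cont, hA_mono, hA_zero, hle]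
      with ω h1 h2 h3 h4 h5 h6 h7 h8
    have := nonneg_add_stopPath h5 h6 h7 (hpath ω) h4 h3 h2 h8 (σ ω)
    simp only [discounted, h1]
    exact this
  refine lintegral_rpow_le_of_tail_le (measurable_gridMax hξ_adapted hσ n).coe_nnreal_real
    (fun ω => NNReal.coe_nonneg _) (by positivity) hq hqp fun x hx => ?_
  have key := rpow_mul_measure_le hpair hY0 hH hξ_adapted hξ_nonneg (gridPoint_mono 0 t n)
    (m := n + 2) (fun i hi => gridPoint_le hi) (fun s => hσ.measurableSet_ge s) hle1 hge hx.le hp0 hp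
  rw [hDeq] at key
  have hxp : 0 < x ^ p := Real.rpow_pos_of_pos hx p
  calc P {ω | x < (gridMax ξ t σ n ω : ℝ)}
      ≤ P {ω | ∃ i < n + 2, ω ∈ {ω | (gridPoint 0 t n i : WithTop ℝ≥0) ≤ σ ω} ∧
          x < ξ (gridPoint 0 t n i) ω} :=
        measure_mono fun ω hω => exists_of_lt_gridMax hx hω
    _ ≤ D / ENNReal.ofReal (x ^ p) := by
        rw [ENNReal.le_div_iff_mul_le (Or.inl (ENNReal.ofReal_pos.2 hxp).ne')
          (Or.inl ENNReal.ofReal_ne_top), mul_comm]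
        exact key
    _ = ENNReal.ofReal ((D.toReal ^ p⁻¹ / x) ^ p) := by
        rw [Real.div_rpow (by positivity) hx.le, Real.rpow_inv_rpow ENNReal.toReal_nonneg hp0.ne',
          ENNReal.ofReal_div_of_pos hxp, ENNReal.ofReal_toReal hD]

end Main

end StochGronwall

/-! ### The theorem: reduction to finite data, localization and Fatou's lemma -/

open StochGronwall in
theorem mainTheorem11 {Ω : Type*} {mΩ : MeasurableSpace Ω} (P : Measure Ω)
    [IsProbabilityMeasure P] (𝓕 : Filtration ℝ≥0 mΩ) (h𝓕 : UsualConditions 𝓕 P)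
    (ξ η A M : ℝ≥0 → Ω → ℝ)
    (hξ_meas : Measurable (fun z : ℝ≥0 × Ω => ξ z.1 z.2))
    (hξ_adapted : StronglyAdapted 𝓕 ξ)
    (hξ_nonneg : ∀ᵐ ω ∂P, ∀ t, 0 ≤ ξ t ω)
    (hξ_cadlag : ∀ᵐ ω ∂P, IsCadlag (fun t => ξ t ω))
    (hη_meas : Measurable (fun z : ℝ≥0 × Ω => η z.1 z.2))
    (hη_adapted : StronglyAdapted 𝓕 η)
    (hη_nonneg : ∀ᵐ ω ∂P, ∀ t, 0 ≤ η t ω)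
    (hA_adapted : StronglyAdapted 𝓕 A)
    (hA_cont : ∀ᵐ ω ∂P, Continuous (fun t => A t ω))
    (hA_mono : ∀ᵐ ω ∂P, Monotone (fun t => A t ω))
    (hA_zero : ∀ᵐ ω ∂P, A 0 ω = 0)
    (hM : IsLocalMartingale M 𝓕 P)
    (hM_zero : ∀ᵐ ω ∂P, M 0 ω = 0)
    -- the integrals are `[0, ∞]`-valued, so the inequality is one between extended reals
    (h_le : ∀ t : ℝ≥0, ∀ᵐ ω ∂P,
      (ξ t ω : EReal) ≤ (ξ 0 ω : EReal)
        + ((∫⁻ s in Icc (0 : ℝ) t, ENNReal.ofReal (η s.toNNReal ω) : ℝ≥0∞) : EReal)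
        + ((∫⁻ s in Icc 0 t, ENNReal.ofReal (ξ s ω) ∂(pathMeasure (fun r => A r ω)) : ℝ≥0∞) :
            EReal)
        + (M t ω : EReal))
    (p q : ℝ) (hq : 0 < q) (hqp : q < p) (hp : p < 1) (t : ℝ≥0) :
    (∫⁻ ω, (⨆ s ∈ Icc (0 : ℝ≥0) t, ENNReal.ofReal (ξ s ω)) ^ q ∂P) ^ (1 / q) ≤
      ENNReal.ofReal ((p / (p - q)) ^ (1 / q))
        * (∫⁻ ω, ENNReal.ofReal (Real.exp (p * A t ω / (1 - p))) ∂P) ^ ((1 - p) / p)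
        * ∫⁻ ω, (ENNReal.ofReal (ξ 0 ω) + ∫⁻ s in Icc (0 : ℝ) t, ENNReal.ofReal (η s.toNNReal ω)) ∂P := by
  have hp0 : 0 < p := hq.trans hqp
  have hpq : 0 < p - q := sub_pos.2 hqp
  set I : ℝ≥0 → Ω → ℝ≥0∞ := fun u ω => ∫⁻ s in Icc (0 : ℝ) u, ENNReal.ofReal (η s.toNNReal ω)
    with hI
  set K := ∫⁻ ω, ENNReal.ofReal (Real.exp (p * A t ω / (1 - p))) ∂P with hK
  set κ := ∫⁻ ω, (ENNReal.ofReal (ξ 0 ω) + I t ω) ∂P with hκ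
  set D := K ^ (1 - p) * κ ^ p with hDdef
  have hDp : D ^ p⁻¹ = K ^ ((1 - p) / p) * κ := by
    rw [hDdef, ENNReal.mul_rpow_of_nonneg _ _ (by positivity), ENNReal.rpow_rpow_inv hp0.ne',
      ← ENNReal.rpow_mul, div_eq_mul_inv]
  rw [mul_assoc, ← hDp]
  have hcpos : 0 < (p / (p - q)) ^ (1 / q) := by positivity
  by_cases hD : D = ∞
  · rw [hD, ENNReal.top_rpow_of_pos (by positivity), ENNReal.mul_top (ENNReal.ofReal_pos.2 hcpos).ne']
    exact le_top
  -- `K ≠ 0` is what lets finiteness of `D` force finiteness of `κ`. The case `K = ∞`, `κ = 0` stays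
  -- included, with `D = 0`.
  have hK1 : 1 ≤ K := by
    calc (1 : ℝ≥0∞) = ∫⁻ _, 1 ∂P := by simp
      _ ≤ K := by
        refine lintegral_mono_ae ?_
        filter_upwards [hA_mono, hA_zero] with ω h1 h2
        rw [ENNReal.one_le_ofReal, Real.one_le_exp_iff]
        have : 0 ≤ A t ω := h2 ▸ h1 (zero_le (a := t))
        have : 0 < 1 - p := by linarith
        positivity
  have hκ_fin : κ ≠ ∞ := by
    intro h
    apply hD
    rw [hDdef, h, ENNReal.top_rpow_of_pos hp0, ENNReal.mul_top]
    exact (ENNReal.rpow_pos_of_nonneg (zero_lt_one.trans_le hK1) (by linarith)).ne'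
  have hIm : Measurable (I t) := by
    have : Measurable (Function.uncurry fun (ω : Ω) (s : ℝ) => ENNReal.ofReal (η s.toNNReal ω)) :=
      (hη_meas.comp ((measurable_real_toNNReal.comp measurable_snd).prodMk
        measurable_fst)).ennreal_ofReal
    exact this.lintegral_prod_right
  have hHm : Measurable (fun ω => ENNReal.ofReal (ξ 0 ω) + I t ω) :=
    (((hξ_adapted 0).mono (𝓕.le 0)).measurable.ennreal_ofReal).add hIm
  set H : Ω → ℝ := fun ω => (ENNReal.ofReal (ξ 0 ω) + I t ω).toReal with hHdef
  have hH : Integrable H P := integrable_toReal_of_lintegral_ne_top hHm.aemeasurable hκ_fin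
  have hH_fin : ∀ᵐ ω ∂P, ENNReal.ofReal (ξ 0 ω) + I t ω < ∞ := ae_lt_top hHm hκ_fin
  have hHκ : ENNReal.ofReal (∫ ω, H ω ∂P) = κ := by
    rw [integral_toReal hHm.aemeasurable hH_fin, ENNReal.ofReal_toReal hκ_fin]
  have hle : ∀ᵐ ω ∂P, ∀ u ≤ t, ξ u ω ≤ H ω + (∫⁻ r in Icc 0 u, ENNReal.ofReal (ξ r ω)
      ∂pathMeasure (fun v => A v ω)).toReal + M u ω := by
    -- The exceptional null set in `h_le` depends on the time, so only countably many times can be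
    -- used at once.
    have hdense : ∀ᵐ ω ∂P, ∀ k, _ :=
      ae_all_iff.2 fun k => h_le (TopologicalSpace.denseSeq ℝ≥0 k)
    filter_upwards [hdense, h_le t, hM.cadlag, hξ_cadlag, hξ_nonneg, hA_cont, hA_mono, hH_fin]
      with ω h1 h2 h3 h4 h5 h6 h7 h8 u hu
    obtain ⟨C, hC⟩ := h4.exists_bound t
    have conv : ∀ v ≤ t, (ξ v ω : EReal) ≤ (ξ 0 ω : EReal) + ((I v ω : ℝ≥0∞) : EReal)
        + ((∫⁻ s in Icc 0 v, ENNReal.ofReal (ξ s ω) ∂(pathMeasure (fun r => A r ω)) : ℝ≥0∞) :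
            EReal) + (M v ω : EReal) →
        ξ v ω ≤ H ω + (∫⁻ r in Icc 0 v, ENNReal.ofReal (ξ r ω)
          ∂pathMeasure (fun v => A v ω)).toReal + M v ω := fun v hv hle =>
      toReal_le_of_ereal_le (h5 0)
        (lintegral_mono_set (Icc_subset_Icc_right (NNReal.coe_le_coe.2 hv)))
        (ENNReal.add_ne_top.1 h8.ne).2 (lintegral_Icc_lt_top h6 h7 hC hv).ne hle
    refine le_of_le_on_dense h6 h7 h4 h3 (TopologicalSpace.denseRange_denseSeq ℝ≥0) ?_
      (conv t le_rfl h2) hu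
    rintro _ ⟨k, rfl⟩ hk
    exact conv _ hk (h1 k)
  obtain ⟨τ, hτ, hmart⟩ := hM.locally_martingale
  have hbound : ∫⁻ ω, (⨆ s ∈ Icc (0 : ℝ≥0) t, ENNReal.ofReal (ξ s ω)) ^ q ∂P ≤
      ENNReal.ofReal (p / (p - q) * (D.toReal ^ p⁻¹) ^ q) := by
    calc _ ≤ ∫⁻ ω, liminf (fun n => ENNReal.ofReal ((gridMax ξ t (τ n) n ω : ℝ) ^ q)) atTop ∂P := by
          refine lintegral_mono_ae ?_
          filter_upwards [hξ_cadlag, hτ.tendsto_top] with ω h1 h2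
            using iSup_rpow_le_liminf h1 h2 hq
      _ ≤ liminf (fun n => ∫⁻ ω, ENNReal.ofReal ((gridMax ξ t (τ n) n ω : ℝ) ^ q) ∂P) atTop :=
          lintegral_liminf_le fun n =>
            ((measurable_gridMax hξ_adapted (hτ.isStoppingTime n) n).coe_nnreal_real.pow_const
              q).ennreal_ofReal
      _ ≤ _ := by
          refine liminf_le_of_le (by isBoundedDefault) fun b hb => ?_
          obtain ⟨n, hn⟩ := hb.exists
          exact hn.trans (lintegral_gridMax_le hξ_meas hξ_adapted hξ_nonneg hξ_cadlag hA_adapted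
            hA_cont hA_mono hA_zero hM.cadlag hM_zero (hτ.isStoppingTime n) (hmart n) hH hle hq hqp
            hp hD (by rw [hHκ]) n)
  calc _ ≤ ENNReal.ofReal (p / (p - q) * (D.toReal ^ p⁻¹) ^ q) ^ (1 / q) := by gcongr
    _ = ENNReal.ofReal ((p / (p - q)) ^ (1 / q)) * D ^ p⁻¹ := by
        have hc0 : 0 ≤ D.toReal ^ p⁻¹ := by positivity
        rw [ENNReal.ofReal_rpow_of_nonneg (by positivity) (by positivity),
          Real.mul_rpow (by positivity) (by positivity), one_div, Real.rpow_rpow_inv hc0 hq.ne',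
          ENNReal.ofReal_mul (by positivity),
          ← ENNReal.ofReal_rpow_of_nonneg ENNReal.toReal_nonneg (by positivity),
          ENNReal.ofReal_toReal hD]
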